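/- Let $K$ be an algebraically closed field (for instance $\overline{\mathbb F}_{q^2}$), let $\mathbf d,\mathbf w\in(\mathbb Z_{\ge 0})^k$ with $\mathbf w_i\le \mathbf d_i$ for all $i$, and let $D$ be a $K$-vector space of dimension $d=\sum_i\mathbf d_i$. Let $\mathfrak T'$ be the tensor product variety, i.e. the variety (with its Zariski topology) of triples $(\mathbf D,W,t)$ where $\mathbf D=(0=\mathbf D_0\subset \mathbf D_1\subset\cdots\subset \mathbf D_k=D)$ is a flag of subspaces with $\dim \mathbf D_i/\mathbf D_{i-1}=\mathbf d_i$, $W\subset D$ is a subspace, and $t\in\operatorname{End}D$ satisfies $t(\mathbf D_i)\subset \mathbf D_{i-1}$ for $1\le i\le k$ and $\operatorname{im}t\subset W\subset\ker t$. For a subspace $U\subset D$ put $\alpha(U,\mathbf D)_i=\dim (U\cap \mathbf D_i)/(U\cap \mathbf D_{i-1})$, and for $\mathbf r,\mathbf n\in(\mathbb Z_{\ge0})^k$ let $$Z'_{\mathbf w}=\{(\mathbf D,W,t)\in\mathfrak T' : \alpha(W,\mathbf D)=\mathbf w\},$$ $$A'_{\mathbf w,\mathbf r,\mathbf n}=\{(\mathbf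 D,W,t)\in Z'_{\mathbf w} : \alpha(\operatorname{im}t,\mathbf D)=\mathbf r,\ \alpha(\ker t,\mathbf D)=\mathbf n\}.$$ Let $M=M(\mathbf d,\mathbf w)$ be the following oriented lower crossingless match. Place $k$ boxes on a line from left to right, the $i$-th with $\mathbf d_i$ vertices; put down arrows on the rightmost $\mathbf w_i$ vertices of box $i$ and up arrows on its other vertices; then, starting from the right, connect each down arrow by a curve to the first unmatched up arrow to its right, if there is any. Let $\mathbf r^M_i$ be the number of left endpoints of curves of $M$ in box $i$, and $\mathbf n^M_i$ be $\mathbf d_i$ minus the number of right endpoints of curves of $M$ in box $i$. (1) $A'_{\mathbf w,\mathbf r^M,\mathbf n^M}$ is an open dense subset of $\overline{Z'_{\mathbf w}}$. In particular $\overline{A'_{\mathbf w,\mathbf r^M,\mathbf n^M}}=\overline{Z'_{\mathbf w}}$. (2) Fix $(\mathbf D,W)$ with $\alpha(W,\mathbf D)=\mathbf w$, and a basis of $D$, divided into successive groups of $\mathbf d_1,\dots,\mathbf d_k$ vectors, such that for each $j$ the first $j$ groups span $\mathbf D_j$, and such that the first $\mathbf w_i$ vectors of the groups $i=1,\dots,k$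 together span $W$. Let $F_1$ be the set of all $t$ with $(\mathbf D,W,t)\in\mathfrak T'$. For $t\in F_1$, the matrix of the induced map $D/W\to W$ in the induced bases is block strictly upper triangular with blocks $A_{l,m}$ of size $\mathbf w_l\times(\mathbf d_m-\mathbf w_m)$; for $1\le i\le j\le k-1$ let $C^{i,j}_t$ be its submatrix with row blocks $i,\dots,j$ and column blocks $i+1,\dots,j+1$. Say that $C^{i,j}_t$ has maximal rank if $\operatorname{rank}C^{i,j}_{t'}\le\operatorname{rank}C^{i,j}_t$ for all $t'\in F_1$. Then, for $t\in F_1$, $(\mathbf D,W,t)\in A'_{\mathbf w,\mathbf r^M,\mathbf n^M}$ if and only if $C^{i,j}_t$ has maximal rank for all $1\le i\le j\le k-1$ with $i=1$ or $j=k-1$. Moreover there is a $t\in F_1$ for which all the $C^{i,j}_t$, $1\le i\le j\le k-1$, have maximal rank simultaneously. -/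

import Mathlib

namespace TensorProductVariety

/-! ### Zariski topology -/

/-- The algebra of polynomial functions on a vector space `V`, i.e. the algebra of functions
generated by the linear forms. -/
def polyFun (K V : Type*) [Field K] [AddCommGroup V] [Module K V] : Subalgebra K (V → K) :=
  Algebra.adjoin K (Set.range fun l : Module.Dual K V => (l : V → K))

/-- The Zariski topology on (the points of) a finite-dimensional vector space, generated by the
principal open sets `f ≠ 0`. -/
@[reducible] def zariski (K V : Type*) [Field K] [AddCommGroup V] [Module K V] : TopologicalSpace V :=
  TopologicalSpace.generateFrom {U | ∃ f ∈ polyFun K V, U = {v | f v ≠ 0}}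

/-! ### The tensor product variety -/

section Variety

variable {K D : Type*} [Field K] [AddCommGroup D] [Module K D] {k : ℕ}

/-- `dim B / A` for subspaces `A ⊆ B`. -/
noncomputable def relDim (A B : Submodule K D) : ℕ :=
  Module.finrank K (B ⧸ A.submoduleOf B)

/-- `α(W, 𝐃)_i = dim (W ∩ 𝐃_i) / (W ∩ 𝐃_{i-1})`. The `i`-th step of the flag, `i : Fin k`,
goes from `F i.castSucc` to `F i.succ`. -/
noncomputable def alpha (W : Submodule K D) (F : Fin (k + 1) → Submodule K D) : Fin k → ℕ :=
  fun i => relDim (W ⊓ F i.castSucc) (W ⊓ F i.succ)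

end Variety

/-- The tensor product variety: triples `(𝐃, W, t)` with
`0 = 𝐃_0 ⊆ 𝐃_1 ⊆ ⋯ ⊆ 𝐃_k = D`, `dim 𝐃_i / 𝐃_{i-1} = d_i`, `t 𝐃_i ⊆ 𝐃_{i-1}`,
`im t ⊆ W ⊆ ker t`. -/
structure TensorVariety (K D : Type*) [Field K] [AddCommGroup D] [Module K D] {k : ℕ}
    (d : Fin k → ℕ) where
  flag : Fin (k + 1) → Submodule K D
  W : Submodule K D
  t : D →ₗ[K] D
  flag_zero : flag 0 = ⊥
  flag_last : flag (Fin.last k) = ⊤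
  flag_le : ∀ i : Fin k, flag i.castSucc ≤ flag i.succ
  flag_dim : ∀ i : Fin k, relDim (flag i.castSucc) (flag i.succ) = d i
  t_flag : ∀ i : Fin k, (flag i.succ).map t ≤ flag i.castSucc
  range_le : LinearMap.range t ≤ W
  le_ker : W ≤ LinearMap.ker t

section Topology

variable (K D : Type*) [Field K] [AddCommGroup D] [Module K D] {k : ℕ} (d : Fin k → ℕ)

/-- The vector space of triples (`d₁ + ⋯ + d_k` vectors of `D` in `k` groups, `m` vectors of `D`,
endomorphism of `D`). -/
abbrev FrameSpace (m : ℕ) : Type _ :=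
  ((Σ i : Fin k, Fin (d i)) → D) × (Fin m → D) × (D →ₗ[K] D)

variable {K D d}

/-- `p = (b, v, t)` is a frame of `x = (𝐃, W, t)`: the vectors of the first `j` groups of `b` form
a basis of `𝐃_j` for every `j`, and `v` is a basis of `W`. -/
structure IsFrame {m : ℕ} (p : FrameSpace K D d m) (x : TensorVariety K D d) : Prop where
  linearIndependent_flag : LinearIndependent K p.1
  linearIndependent_W : LinearIndependent K p.2.1
  flag_eq : ∀ j : Fin (k + 1), x.flag j = Submodule.span K (p.1 '' {v | v.1.castSucc < j})
  W_eq : x.W = Submodule.span K (Set.range p.2.1)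
  t_eq : x.t = p.2.2

variable (K D d)

/-- Points of the tensor product variety with `dim W = m`, together with a frame. -/
abbrev Framed (m : ℕ) : Type _ :=
  {q : FrameSpace K D d m × TensorVariety K D d // IsFrame q.1 q.2}

/-- The Zariski topology on the tensor product variety. Partial flag varieties and Grassmannians
are the quotients of the varieties of frames (linearly independent families, a subvariety of a
vector space) by the change of frame, and their Zariski topology is the quotient topology; so a
subset of the tensor product variety is open if and only if, for every `m`, the set of the frames
of its points with `dim W = m` is Zariski open in the set of all frames. -/
instance : TopologicalSpace (TensorVariety K D d) :=
  ⨆ m : ℕ, TopologicalSpace.coinduced (fun q : Framed K D d m => q.1.2)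
    (TopologicalSpace.induced (fun q : Framed K D d m => q.1.1) (zariski K (FrameSpace K D d m)))

/-- `Z'_w`: the locus `α(W, 𝐃) = w`. -/
def Z (w : Fin k → ℕ) : Set (TensorVariety K D d) :=
  {x | alpha x.W x.flag = w}

/-- `A'_{w,r,n}`: the locus `α(W, 𝐃) = w`, `α(im t, 𝐃) = r`, `α(ker t, 𝐃) = n`. -/
def A (w r n : Fin k → ℕ) : Set (TensorVariety K D d) :=
  {x | alpha x.W x.flag = w ∧ alpha (LinearMap.range x.t) x.flag = r ∧
    alpha (LinearMap.ker x.t) x.flag = n}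

end Topology

/-! ### The oriented lower crossingless match `M(d, w)` -/

section Match

variable {k : ℕ} (d w : Fin k → ℕ)

/-- The vertices, read from left to right: box `i` has `d i` vertices. -/
abbrev Vertex : Type := Σₗ i : Fin k, Fin (d i)

variable {d}

/-- The box of a vertex. -/
def box (v : Vertex d) : Fin k := (ofLex v).1

/-- The rightmost `w i` vertices of box `i` carry down arrows, the others carry up arrows. -/
def IsDown (v : Vertex d) : Prop := d (ofLex v).1 ≤ ((ofLex v).2 : ℕ) + w (ofLex v).1

instance : DecidablePred (IsDown (d := d) w) := fun _ => Nat.decLe _ _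

/-- The up arrows to the right of `a` that are not an endpoint of a curve in `M`. -/
def freeUp (M : Finset (Vertex d × Vertex d)) (a : Vertex d) : Finset (Vertex d) :=
  Finset.univ.filter fun b => a < b ∧ ¬ IsDown w b ∧ ∀ c ∈ M, c.2 ≠ b

/-- Connect the down arrow `a` to the first unmatched up arrow to its right, if there is any. -/
def connect (M : Finset (Vertex d × Vertex d)) (a : Vertex d) : Finset (Vertex d × Vertex d) :=
  if h : (freeUp w M a).Nonempty then insert (a, (freeUp w M a).min' h) M else M

variable (d)

/-- `M(d, w)`: starting from the right, each down arrow is connected to the first unmatched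
up arrow to its right, if there is any. A curve is recorded as the pair of its left and its right
endpoint. -/
def crossinglessMatch : Finset (Vertex d × Vertex d) :=
  (((Finset.univ : Finset (Vertex d)).filter fun a => IsDown w a).sort (· ≥ ·)).foldl
    (connect w) ∅

variable {d}

/-- `r^M_i`: the number of left endpoints of curves in box `i`. -/
def rVec (M : Finset (Vertex d × Vertex d)) : Fin k → ℕ :=
  fun i => (M.filter fun c => box c.1 = i).card

/-- `n^M_i`: `d_i` minus the number of right endpoints of curves in box `i`. -/
def nVec (M : Finset (Vertex d × Vertex d)) : Fin k → ℕ :=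
  fun i => d i - (M.filter fun c => box c.2 = i).card

end Match

/-! ### Block submatrices -/

section Blocks

variable {K D : Type*} [Field K] [AddCommGroup D] [Module K D] {k : ℕ} {d : Fin k → ℕ}

/-- A basis of `D`, in groups of `d_1, …, d_k` vectors, is adapted to `(𝐃, W)`: the vectors of
the first `j` groups span `𝐃_j`, and the first `w i` vectors of the groups `i` together span `W`. -/
structure IsAdapted (b : Module.Basis (Σ i : Fin k, Fin (d i)) K D) (w : Fin k → ℕ)
    (F : Fin (k + 1) → Submodule K D) (W : Submodule K D) : Prop where
  flag_eq : ∀ j : Fin (k + 1), F j = Submodule.span K (b '' {v | v.1.castSucc < j})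
  W_eq : W = Submodule.span K (b '' {v | (v.2 : ℕ) < w v.1})

/-- The submatrix, with row blocks `p, …, q - 1` and column blocks `p + 1, …, q`, of the matrix of
the map `D / W → W` induced by `t` in the bases given by an adapted basis `b`: block `l` of rows is
given by the first `w l` vectors of group `l` of `b`, block `m` of columns by the last `d m - w m`
vectors of group `m`. -/
noncomputable def blockMatrix (b : Module.Basis (Σ i : Fin k, Fin (d i)) K D) (w : Fin k → ℕ)
    (t : D →ₗ[K] D) (p q : Fin k) :
    Matrix {v : Σ i : Fin k, Fin (d i) // p ≤ v.1 ∧ v.1 < q ∧ (v.2 : ℕ) < w v.1}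
      {v : Σ i : Fin k, Fin (d i) // p < v.1 ∧ v.1 ≤ q ∧ w v.1 ≤ (v.2 : ℕ)} K :=
  (LinearMap.toMatrix b b t).submatrix Subtype.val Subtype.val

/-- The `(p, q)` block submatrix of `x` has the largest rank among all the points `(𝐃, W, t')` of
the tensor product variety over the same `(𝐃, W)`. -/
def HasMaxRank (x : TensorVariety K D d) (b : Module.Basis (Σ i : Fin k, Fin (d i)) K D)
    (w : Fin k → ℕ) (p q : Fin k) : Prop :=
  ∀ y : TensorVariety K D d, y.flag = x.flag → y.W = x.W →
    (blockMatrix b w y.t p q).rank ≤ (blockMatrix b w x.t p q).rank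

end Blocks

end TensorProductVariety

/-! Everything is read off from the numbers `dim (t 𝐃_j + 𝐃_i)`. Those with `i = 0` encode `α(ker t,
𝐃)`; together with them, those with `j = k` encode `α(im t, 𝐃)`. In an adapted basis such a number
is, up to `dim 𝐃_i`, the rank of a block submatrix (`rank_blockMatrix`).

Strict block triangularity bounds these ranks: by the number of rows, and, for every `s`, by the
number of rows above plus the number of columns to the right of the zero block at `s`. The greedy
match reaches one of these bounds in every interval of boxes (`IsGreedy.le_arcCount`). If all down
arrows of the interval are matched inside it, the curves count the rows. Otherwise let `s` be the
box of the leftmost one that is not: down arrows in earlier boxes are matched inside, and all up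
arrows in later boxes are used up.

Conversely, the partial permutation that sends right endpoints of curves to left endpoints has at
least as many dimensions as there are curves, for all intervals at once
(`IsGreedy.le_imageDim_matchPoint`). So curve counts are the maximal ranks, attained simultaneously,
and `A` is the part of `Z` where the ranks with `i = 0` or `j = k` are maximal
(`IsGreedy.mem_A_iff`).

Lower bounds on ranks are Zariski open, so `A` is open in the closure of `Z`. For density, the line
of endomorphisms from any point of `Z` to the partial permutation over the same `(𝐃, W)` stays in
`Z`, and all but finitely many of its points lie in any given open set that it meets. -/

namespace TensorProductVariety

/-! ### Partial sums -/

section PartialSum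

variable {k : ℕ}

/-- The sum of the values `u i` over the steps `i` of a flag that end at or before `j`. -/
def partialSum (u : Fin k → ℕ) (j : Fin (k + 1)) : ℕ :=
  ∑ i with i.castSucc < j, u i

@[simp] lemma partialSum_zero (u : Fin k → ℕ) : partialSum u 0 = 0 := by
  simp [partialSum]

lemma partialSum_last (u : Fin k → ℕ) : partialSum u (Fin.last k) = ∑ i, u i := by
  simp [partialSum, Fin.castSucc_lt_last]

lemma partialSum_succ (u : Fin k → ℕ) (i : Fin k) :
    partialSum u i.succ = partialSum u i.castSucc + u i := by
  have h : (Finset.univ.filter fun l : Fin k => l.castSucc < i.succ) =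
      insert i (Finset.univ.filter fun l : Fin k => l.castSucc < i.castSucc) := by
    ext l
    simp [Fin.castSucc_lt_succ_iff, le_iff_eq_or_lt]
  rw [partialSum, h, Finset.sum_insert (by simp), add_comm]
  rfl

lemma eq_partialSum_iff {u : Fin k → ℕ} {v : Fin (k + 1) → ℕ} (h0 : v 0 = 0) :
    (∀ j, v j = partialSum u j) ↔ ∀ i, v i.succ = v i.castSucc + u i := by
  constructor
  · intro h i
    rw [h, h, partialSum_succ]
  · intro h j
    induction j using Fin.induction with
    | zero => simpa using h0
    | succ i ih => rw [h, ih, partialSum_succ]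

lemma partialSum_sub {u v : Fin k → ℕ} (h : ∀ i, u i ≤ v i) (j : Fin (k + 1)) :
    partialSum (fun i => v i - u i) j + partialSum u j = partialSum v j := by
  rw [partialSum, partialSum, partialSum, ← Finset.sum_add_distrib]
  exact Finset.sum_congr rfl fun i _ => Nat.sub_add_cancel (h i)

end PartialSum

/-! ### Dimensions along a flag -/

section Dimension

open Module

variable {K D : Type*} [Field K] [AddCommGroup D] [Module K D] [FiniteDimensional K D] {k : ℕ}

lemma relDim_add_finrank {A B : Submodule K D} (h : A ≤ B) :
    relDim A B + finrank K A = finrank K B := by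
  rw [relDim, ← (Submodule.submoduleOfEquivOfLe h).finrank_eq,
    Submodule.finrank_quotient_add_finrank]

lemma finrank_map_add_finrank_ker_inf {E : Type*} [AddCommGroup E] [Module K E]
    (f : D →ₗ[K] E) (p : Submodule K D) :
    finrank K (p.map f) + finrank K (LinearMap.ker f ⊓ p : Submodule K D) = finrank K p := by
  have h := LinearMap.finrank_range_add_finrank_ker (f.domRestrict p)
  rw [LinearMap.range_domRestrict] at h
  rw [← h, inf_comm, ← Submodule.map_comap_subtype, Submodule.finrank_map_subtype_eq]
  rfl

/-- Telescoping the step dimensions from `F 0 = ⊥` trades `α` for dimensions of intersections, which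
are semicontinuous. -/
lemma alpha_eq_iff {F : Fin (k + 1) → Submodule K D} (h0 : F 0 = ⊥)
    (hF : ∀ i : Fin k, F i.castSucc ≤ F i.succ) (U : Submodule K D) (u : Fin k → ℕ) :
    alpha U F = u ↔ ∀ j, finrank K (U ⊓ F j : Submodule K D) = partialSum u j := by
  rw [eq_partialSum_iff (v := fun j => finrank K (U ⊓ F j : Submodule K D)) (by simp [h0]),
    funext_iff]
  refine forall_congr' fun i => ?_
  have := relDim_add_finrank (inf_le_inf_left U (hF i))
  simp only [alpha]
  omega

end Dimension

/-! ### Upper bounds for the dimension of `t 𝐃_j + 𝐃_i`. -/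

section Variety

open Module

variable {K D : Type*} [Field K] [AddCommGroup D] [Module K D] {k : ℕ}
  {d : Fin k → ℕ}

namespace TensorVariety

variable (x : TensorVariety K D d)

lemma monotone_flag : Monotone x.flag := Fin.monotone_iff_le_succ.2 x.flag_le

lemma map_flag_le_W (j : Fin (k + 1)) : (x.flag j).map x.t ≤ x.W :=
  (LinearMap.map_le_range).trans x.range_le

lemma map_flag_le {i j : Fin (k + 1)} (h : j ≤ i) : (x.flag j).map x.t ≤ x.flag i := by
  induction j using Fin.cases with
  | zero => simp [x.flag_zero]
  | succ s => exact (x.t_flag s).trans (x.monotone_flag ((Fin.castSucc_lt_succ).le.trans h))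

variable [FiniteDimensional K D]

lemma finrank_flag (j : Fin (k + 1)) : finrank K (x.flag j) = partialSum d j := by
  refine (eq_partialSum_iff (v := fun j => finrank K (x.flag j)) (by simp [x.flag_zero])).2
    (fun i => ?_) j
  have := relDim_add_finrank (x.flag_le i)
  rw [x.flag_dim] at this
  omega

/-- The dimension of `t 𝐃_j + 𝐃_i`. -/
noncomputable def imageDim (i j : Fin (k + 1)) : ℕ :=
  finrank K ((x.flag j).map x.t ⊔ x.flag i : Submodule K D)

/-- Modulo `𝐃_i`, the space `W ∩ 𝐃_s` loses exactly `W ∩ 𝐃_i`; what remains counts the rows in the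
blocks from `i` up to `s`. -/
lemma finrank_W_sup {w : Fin k → ℕ} (hx : x ∈ Z K D d w) (s i : Fin (k + 1)) (h : i ≤ s) :
    finrank K ((x.W ⊓ x.flag s) ⊔ x.flag i : Submodule K D) + partialSum w i =
      partialSum w s + partialSum d i := by
  have hW := (alpha_eq_iff x.flag_zero x.flag_le x.W w).1 hx
  have h1 := Submodule.finrank_sup_add_finrank_inf_eq (x.W ⊓ x.flag s) (x.flag i)
  rwa [inf_assoc, inf_eq_right.2 (x.monotone_flag h), hW, hW, x.finrank_flag] at h1

/-- `t 𝐃_j` has at most `∑_{i ≤ l < j} w_l` dimensions modulo `𝐃_i`. -/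
lemma imageDim_le_rows {w : Fin k → ℕ} (hx : x ∈ Z K D d w) {i j : Fin (k + 1)} (h : i ≤ j) :
    x.imageDim i j + partialSum w i ≤ partialSum w j + partialSum d i := by
  rw [← x.finrank_W_sup hx j i h]
  gcongr
  apply Submodule.finrank_mono
  gcongr
  exact le_inf (x.map_flag_le_W j) (x.map_flag_le le_rfl)

/-- As `t` kills `W`, the map `𝐃_j → D / T` factors through `𝐃_j / ((W ∩ 𝐃_j) + 𝐃_i)`, whose
dimension is the number of columns in the blocks from `i` up to `j`. -/
lemma finrank_map_le {w : Fin k → ℕ} (hx : x ∈ Z K D d w) (hw : ∀ i, w i ≤ d i)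
    {i j : Fin (k + 1)} (h : i ≤ j) (T : Submodule K D) (hT : (x.flag i).map x.t ≤ T) :
    finrank K ((x.flag j).map x.t ⊔ T : Submodule K D) + partialSum (fun i => d i - w i) i ≤
      finrank K T + partialSum (fun i => d i - w i) j := by
  have h1 := x.finrank_W_sup hx j i h
  set S : Submodule K D := (x.W ⊓ x.flag j) ⊔ x.flag i with hS
  have hSj : S ≤ x.flag j := sup_le inf_le_right (x.monotone_flag h)
  have hST : S.map x.t ≤ T := by
    rw [hS, Submodule.map_sup]
    refine sup_le ?_ hT
    rintro _ ⟨v, hv, rfl⟩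
    rw [LinearMap.mem_ker.1 (x.le_ker hv.1)]
    exact zero_mem _
  have h2 := finrank_map_add_finrank_ker_inf x.t S
  have h3 := finrank_map_add_finrank_ker_inf x.t (x.flag j)
  have h4 := Submodule.finrank_sup_add_finrank_inf_eq ((x.flag j).map x.t) T
  have h5 : finrank K (S.map x.t) ≤ finrank K ((x.flag j).map x.t ⊓ T : Submodule K D) :=
    Submodule.finrank_mono (le_inf (Submodule.map_mono hSj) hST)
  have h6 : finrank K (LinearMap.ker x.t ⊓ S : Submodule K D) ≤
      finrank K (LinearMap.ker x.t ⊓ x.flag j : Submodule K D) :=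
    Submodule.finrank_mono (inf_le_inf_left _ hSj)
  rw [x.finrank_flag] at h3
  have h7 := partialSum_sub hw i
  have h8 := partialSum_sub hw j
  omega

/-- The zero block below row `s` and left of column `s + 1` bounds the dimension of `t 𝐃_j`
modulo `𝐃_i`. -/
lemma imageDim_le_rows_add_cols {w : Fin k → ℕ} (hx : x ∈ Z K D d w) (hw : ∀ i, w i ≤ d i)
    {i j : Fin (k + 1)} {s : Fin k} (his : i ≤ s.castSucc) (hsj : s.succ ≤ j) :
    x.imageDim i j + partialSum w i + partialSum (fun i => d i - w i) s.succ ≤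
      partialSum w s.castSucc + partialSum d i + partialSum (fun i => d i - w i) j := by
  have h1 := x.finrank_W_sup hx s.castSucc i his
  -- The zero block is the inclusion of `t 𝐃_{s+1}` in `W ∩ 𝐃_s`: only the columns after step `s`
  -- can leave `(W ∩ 𝐃_s) + 𝐃_i`, and this space accounts for the rows before `s`.
  have h2 := x.finrank_map_le hx hw hsj ((x.W ⊓ x.flag s.castSucc) ⊔ x.flag i)
    (le_sup_of_le_left (le_inf (x.map_flag_le_W _) (x.t_flag s)))
  have h3 : x.imageDim i j ≤ finrank K ((x.flag j).map x.t ⊔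
      ((x.W ⊓ x.flag s.castSucc) ⊔ x.flag i) : Submodule K D) := by
    apply Submodule.finrank_mono
    gcongr
    exact le_sup_right
  omega

end TensorVariety

end Variety

/-! ### Combinatorics of the crossingless match -/

section Match

variable {k : ℕ} {d : Fin k → ℕ} {w : Fin k → ℕ}

/-- `M` is the set of curves obtained from the down arrows in `L`: it is a partial matching of
these with up arrows to their right, and an up arrow to the right of `a ∈ L` can be left over
only if `a` is matched before it. -/
structure IsGreedy (w : Fin k → ℕ) (L : Set (Vertex d)) (M : Finset (Vertex d × Vertex d)) :
    Prop where
  fst_mem : ∀ c ∈ M, c.1 ∈ L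
  not_isDown : ∀ c ∈ M, ¬ IsDown w c.2
  lt : ∀ c ∈ M, c.1 < c.2
  fst_inj : ∀ c ∈ M, ∀ c' ∈ M, c.1 = c'.1 → c = c'
  snd_inj : ∀ c ∈ M, ∀ c' ∈ M, c.2 = c'.2 → c = c'
  greedy : ∀ a ∈ L, ∀ b, ¬ IsDown w b → a < b →
    ∃ c ∈ M, (c.1 = a ∧ c.2 ≤ b) ∨ (c.2 = b ∧ a < c.1)

/-- Since `a` is to the left of everything in `L`, an up arrow to the right of `a` that is no longer
free was taken by a curve starting to the right of `a`; a free one is no closer than the partner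
chosen for `a`. -/
lemma IsGreedy.connect {L : Set (Vertex d)} {M : Finset (Vertex d × Vertex d)}
    (h : IsGreedy w L M) {a : Vertex d} (ha : ∀ a' ∈ L, a < a') :
    IsGreedy w (insert a L) (connect w M a) := by
  have haL : a ∉ L := fun h' => lt_irrefl _ (ha a h')
  have key : ∀ b, ¬ IsDown w b → a < b → b ∉ freeUp w M a →
      ∃ c ∈ M, c.2 = b ∧ a < c.1 := by
    intro b hb hab hfree
    simp only [freeUp, Finset.mem_filter, Finset.mem_univ, true_and, not_and, not_forall,
      not_not] at hfree
    obtain ⟨c, hc, hcb⟩ := hfree hab hb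
    exact ⟨c, hc, hcb, ha _ (h.fst_mem c hc)⟩
  unfold TensorProductVariety.connect
  split_ifs with hne
  · have hmem := Finset.min'_mem _ hne
    have hmin : ∀ b ∈ freeUp w M a, (freeUp w M a).min' hne ≤ b := fun b => Finset.min'_le _ b
    generalize (freeUp w M a).min' hne = m at hmem hmin ⊢
    simp only [freeUp, Finset.mem_filter, Finset.mem_univ, true_and] at hmem
    obtain ⟨hm1, hm2, hm3⟩ := hmem
    refine ⟨?_, ?_, ?_, ?_, ?_, ?_⟩
    · intro c hc
      rcases Finset.mem_insert.1 hc with rfl | hc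
      · exact Set.mem_insert _ _
      · exact Set.mem_insert_of_mem _ (h.fst_mem c hc)
    · intro c hc
      rcases Finset.mem_insert.1 hc with rfl | hc
      · exact hm2
      · exact h.not_isDown c hc
    · intro c hc
      rcases Finset.mem_insert.1 hc with rfl | hc
      · exact hm1
      · exact h.lt c hc
    · intro c hc c' hc' e
      rcases Finset.mem_insert.1 hc with rfl | hc <;> rcases Finset.mem_insert.1 hc' with rfl | hc'
      · rfl
      · exact absurd (show a ∈ L from (show a = c'.1 from e) ▸ h.fst_mem c' hc') haL
      · exact absurd (show a ∈ L from (show c.1 = a from e) ▸ h.fst_mem c hc) haL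
      · exact h.fst_inj c hc c' hc' e
    · intro c hc c' hc' e
      rcases Finset.mem_insert.1 hc with rfl | hc <;> rcases Finset.mem_insert.1 hc' with rfl | hc'
      · rfl
      · exact absurd e.symm (hm3 c' hc')
      · exact absurd e (hm3 c hc)
      · exact h.snd_inj c hc c' hc' e
    · intro a' ha' b hb hab
      rcases Set.mem_insert_iff.1 ha' with rfl | ha'
      · by_cases hfree : b ∈ freeUp w M a'
        · exact ⟨_, Finset.mem_insert_self _ _, Or.inl ⟨rfl, hmin b hfree⟩⟩
        · obtain ⟨c, hc, hc'⟩ := key b hb hab hfree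
          exact ⟨c, Finset.mem_insert_of_mem hc, Or.inr hc'⟩
      · obtain ⟨c, hc, hc'⟩ := h.greedy a' ha' b hb hab
        exact ⟨c, Finset.mem_insert_of_mem hc, hc'⟩
  · refine ⟨fun c hc => Set.mem_insert_of_mem _ (h.fst_mem c hc), h.not_isDown, h.lt, h.fst_inj,
      h.snd_inj, ?_⟩
    intro a' ha' b hb hab
    rcases Set.mem_insert_iff.1 ha' with rfl | ha'
    · obtain ⟨c, hc, hc'⟩ := key b hb hab fun hf => hne ⟨b, hf⟩
      exact ⟨c, hc, Or.inr hc'⟩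
    · exact h.greedy a' ha' b hb hab

lemma IsGreedy.foldl {l : List (Vertex d)} : ∀ {L : Set (Vertex d)}
    {M : Finset (Vertex d × Vertex d)}, IsGreedy w L M → (∀ a ∈ l, ∀ a' ∈ L, a < a') →
    l.Pairwise (· > ·) → IsGreedy w (L ∪ {a | a ∈ l}) (l.foldl (TensorProductVariety.connect w) M) := by
  induction l with
  | nil => intro L M h _ _; simpa using h
  | cons a l ih =>
    intro L M h hl hp
    rw [List.pairwise_cons] at hp
    have h1 := h.connect (hl a List.mem_cons_self)
    have h2 := ih h1 (fun b hb a' ha' => by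
      rcases Set.mem_insert_iff.1 ha' with rfl | ha'
      · exact hp.1 b hb
      · exact hl b (List.mem_cons_of_mem _ hb) a' ha') hp.2
    have h3 : L ∪ {b | b ∈ a :: l} = insert a L ∪ {b | b ∈ l} := by
      ext b
      simp only [Set.mem_union, Set.mem_ofPred_eq, List.mem_cons, Set.mem_insert_iff]
      tauto
    rw [h3]
    exact h2

lemma isGreedy_crossinglessMatch (d w : Fin k → ℕ) :
    IsGreedy w {a | IsDown w a} (crossinglessMatch d w) := by
  have h0 : IsGreedy w (∅ : Set (Vertex d)) ∅ := by
    constructor <;> simp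
  have h := h0.foldl (l := ((Finset.univ : Finset (Vertex d)).filter
    fun a => IsDown w a).sort (· ≥ ·)) (by simp) (Finset.sortedGT_sort _).pairwise
  have h1 : {a : Vertex d | IsDown w a} = ∅ ∪ {a | a ∈ ((Finset.univ : Finset (Vertex d)).filter
      fun a => IsDown w a).sort (· ≥ ·)} := by
    ext a
    simp
  rw [h1]
  exact h

/-- The number of curves of `M` with both endpoints in the boxes of the steps from `i` to `j`. -/
def arcCount (M : Finset (Vertex d × Vertex d)) (i j : Fin (k + 1)) : ℕ :=
  (M.filter fun c => i ≤ (box c.1).castSucc ∧ (box c.2).castSucc < j).card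

lemma box_mono {a b : Vertex d} (h : a ≤ b) : box a ≤ box b := by
  rcases Sigma.Lex.le_def.1 h with h | ⟨h, -⟩
  · exact h.le
  · exact h.le

lemma lt_of_box_lt {a b : Vertex d} (h : box a < box b) : a < b :=
  Sigma.Lex.lt_def.2 (Or.inl h)

/-- Inside a box, the up arrows are to the left of the down arrows. -/
lemma box_lt {a b : Vertex d} (ha : IsDown w a) (hb : ¬ IsDown w b) (h : a < b) :
    box a < box b := by
  obtain ⟨i, a⟩ := a
  obtain ⟨j, b⟩ := b
  rcases Sigma.Lex.lt_def.1 h with h | ⟨h, h'⟩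
  · exact h
  · change i = j at h
    subst h
    have h2 : a < b := h'
    change d i ≤ (a : ℕ) + w i at ha
    change ¬ d i ≤ (b : ℕ) + w i at hb
    rw [Fin.lt_def] at h2
    omega

lemma IsGreedy.box_lt {M : Finset (Vertex d × Vertex d)} (h : IsGreedy w {a | IsDown w a} M)
    {c : Vertex d × Vertex d} (hc : c ∈ M) : box c.1 < box c.2 :=
  TensorProductVariety.box_lt (h.fst_mem c hc) (h.not_isDown c hc) (h.lt c hc)

lemma card_filter_box (P : ∀ i, Fin (d i) → Prop) [∀ i, DecidablePred (P i)]
    (Q : Fin k → Prop) [DecidablePred Q] :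
    (Finset.univ.filter fun v : Vertex d => Q (box v) ∧ P (ofLex v).1 (ofLex v).2).card =
      ∑ i with Q i, (Finset.univ.filter (P i)).card := by
  rw [← Finset.card_sigma]
  refine Finset.card_bij (fun v _ => ofLex v) ?_ ?_ ?_
  · intro v hv
    obtain ⟨-, h1, h2⟩ := Finset.mem_filter.1 hv
    exact Finset.mem_sigma.2 ⟨Finset.mem_filter.2 ⟨Finset.mem_univ _, h1⟩,
      Finset.mem_filter.2 ⟨Finset.mem_univ _, h2⟩⟩
  · intro v _ v' _ h
    exact ofLex.injective h
  · intro v hv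
    obtain ⟨h1, h2⟩ := Finset.mem_sigma.1 hv
    exact ⟨toLex v, Finset.mem_filter.2 ⟨Finset.mem_univ _, (Finset.mem_filter.1 h1).2,
      (Finset.mem_filter.1 h2).2⟩, rfl⟩

lemma card_isDown (hw : ∀ i, w i ≤ d i) (j : Fin (k + 1)) :
    (Finset.univ.filter fun v : Vertex d => (box v).castSucc < j ∧ IsDown w v).card =
      partialSum w j := by
  rw [partialSum]
  have h := card_filter_box (d := d) (fun i a => d i ≤ (a : ℕ) + w i) (fun i => i.castSucc < j)
  refine h.trans (Finset.sum_congr rfl fun i _ => ?_)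
  have h1 : (Finset.univ.filter fun a : Fin (d i) => ¬ d i ≤ (a : ℕ) + w i).card = d i - w i := by
    have := Fin.card_filter_val_lt (n := d i) (m := d i - w i)
    rw [min_eq_right (Nat.sub_le _ _)] at this
    rw [← this]
    congr 1
    ext a
    simp
    omega
  have h2 := Finset.card_filter_add_card_filter_not (s := (Finset.univ : Finset (Fin (d i))))
    (fun a => d i ≤ (a : ℕ) + w i)
  rw [h1, Finset.card_univ, Fintype.card_fin] at h2
  have := hw i
  omega

lemma card_vertex (j : Fin (k + 1)) :
    (Finset.univ.filter fun v : Vertex d => (box v).castSucc < j).card = partialSum d j := by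
  rw [partialSum]
  have h := card_filter_box (d := d) (fun i a => True) (fun i => i.castSucc < j)
  simpa using h

lemma card_not_isDown (hw : ∀ i, w i ≤ d i) (j : Fin (k + 1)) :
    (Finset.univ.filter fun v : Vertex d => (box v).castSucc < j ∧ ¬ IsDown w v).card =
      partialSum (fun i => d i - w i) j := by
  have h1 := card_isDown (d := d) hw j
  have h2 := card_vertex (d := d) j
  have h3 := partialSum_sub hw j
  rw [← Finset.card_filter_add_card_filter_not (IsDown w), Finset.filter_filter,
    Finset.filter_filter, h1] at h2
  omega

lemma card_filter_between (P : Vertex d → Prop) [DecidablePred P] {i j : Fin (k + 1)} (h : i ≤ j) :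
    (Finset.univ.filter fun v => (i ≤ (box v).castSucc ∧ (box v).castSucc < j) ∧ P v).card +
      (Finset.univ.filter fun v => (box v).castSucc < i ∧ P v).card =
      (Finset.univ.filter fun v => (box v).castSucc < j ∧ P v).card := by
  rw [← Finset.card_union_of_disjoint]
  · congr 1
    ext v
    simp only [Finset.mem_union, Finset.mem_filter, Finset.mem_univ, true_and]
    constructor
    · rintro (h' | h')
      · exact ⟨h'.1.2, h'.2⟩
      · exact ⟨h'.1.trans_le h, h'.2⟩
    · rintro ⟨h1, h2⟩
      rcases lt_or_ge (box v).castSucc i with h3 | h3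
      · exact Or.inr ⟨h3, h2⟩
      · exact Or.inl ⟨⟨h3, h1⟩, h2⟩
  · rw [Finset.disjoint_left]
    intro v
    simp only [Finset.mem_filter, Finset.mem_univ, true_and]
    rintro ⟨⟨h1, -⟩, -⟩ ⟨h2, -⟩
    exact absurd h1 (not_le.2 h2)

/-- The number of curves of the match inside an interval of boxes attains the bound given by all
the down arrows in it, or by the down arrows before and the up arrows after some box. -/
lemma IsGreedy.le_arcCount {M : Finset (Vertex d × Vertex d)}
    (h : IsGreedy w {a | IsDown w a} M) (hw : ∀ i, w i ≤ d i) {i j : Fin (k + 1)} (hij : i ≤ j) :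
    partialSum w j ≤ arcCount M i j + partialSum w i ∨
    ∃ s : Fin k, i ≤ s.castSucc ∧ s.succ ≤ j ∧
      partialSum w s.castSucc + partialSum (fun i => d i - w i) j ≤
        arcCount M i j + partialSum w i + partialSum (fun i => d i - w i) s.succ := by
  classical
  -- Down arrows of the interval with no curve ending before `j`.
  let unmatched : Finset (Vertex d) := Finset.univ.filter fun a =>
    (i ≤ (box a).castSucc ∧ (box a).castSucc < j) ∧ IsDown w a ∧
      ∀ c ∈ M, c.1 = a → ¬ (box c.2).castSucc < j
  rcases unmatched.eq_empty_or_nonempty with he | hne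
  · left
    rw [← card_isDown (d := d) hw, ← card_isDown (d := d) hw,
      ← card_filter_between (IsDown w) hij]
    gcongr
    refine Finset.card_le_card_of_surjOn Prod.fst ?_
    intro a ha
    simp only [Finset.coe_filter, Finset.mem_univ, true_and, Set.mem_ofPred_eq] at ha
    have h1 : a ∉ unmatched := by simp [he]
    simp only [unmatched, Finset.mem_filter, Finset.mem_univ, true_and, not_and, not_forall,
      not_not] at h1
    obtain ⟨c, hc, hca, hcj⟩ := h1 ha.1 ha.2
    refine ⟨c, ?_, hca⟩
    simp only [Finset.coe_filter, Set.mem_ofPred_eq]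
    exact ⟨hc, hca ▸ ha.1.1, hcj⟩
  · right
    have hmem := Finset.min'_mem _ hne
    have hmin : ∀ b ∈ unmatched, unmatched.min' hne ≤ b := fun b => Finset.min'_le _ b
    generalize unmatched.min' hne = a at hmem hmin
    simp only [unmatched, Finset.mem_filter, Finset.mem_univ, true_and] at hmem
    obtain ⟨⟨hia, haj⟩, hda, hua⟩ := hmem
    have hsj : (box a).succ ≤ j := haj
    -- The witness is the box of the leftmost such arrow `a`. Curves inside the interval are split
    -- according to whether they start in a box before that of `a`.
    refine ⟨box a, hia, hsj, ?_⟩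
    have e1 := card_filter_between (d := d) (IsDown w) hia
    have e2 := card_filter_between (d := d) (fun v => ¬ IsDown w v) hsj
    rw [card_isDown hw, card_isDown hw] at e1
    rw [card_not_isDown hw, card_not_isDown hw] at e2
    have e3 : (M.filter fun c => (i ≤ (box c.1).castSucc ∧ (box c.2).castSucc < j) ∧
        box c.1 < box a).card + (M.filter fun c =>
        (i ≤ (box c.1).castSucc ∧ (box c.2).castSucc < j) ∧ ¬ box c.1 < box a).card =
        arcCount M i j := by
      rw [arcCount, ← Finset.card_filter_add_card_filter_not
        (s := M.filter fun c => i ≤ (box c.1).castSucc ∧ (box c.2).castSucc < j)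
        (fun c => box c.1 < box a), Finset.filter_filter, Finset.filter_filter]
    -- By minimality of `a`, every down arrow in an earlier box starts a curve inside the interval.
    have e4 : (Finset.univ.filter fun v : Vertex d => (i ≤ (box v).castSucc ∧
        (box v).castSucc < (box a).castSucc) ∧ IsDown w v).card ≤
        (M.filter fun c => (i ≤ (box c.1).castSucc ∧ (box c.2).castSucc < j) ∧
        box c.1 < box a).card := by
      refine Finset.card_le_card_of_surjOn Prod.fst ?_
      intro b hb
      simp only [Finset.coe_filter, Finset.mem_univ, true_and, Set.mem_ofPred_eq] at hb
      have hba : box b < box a := hb.1.2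
      have h1 : b ∉ unmatched := fun hb' => not_le.2 hba (box_mono (hmin b hb'))
      simp only [unmatched, Finset.mem_filter, Finset.mem_univ, true_and, not_and, not_forall,
        not_not] at h1
      obtain ⟨c, hc, hcb, hcj⟩ := h1 ⟨hb.1.1, hb.1.2.trans haj⟩ hb.2
      refine ⟨c, ?_, hcb⟩
      simp only [Finset.coe_filter, Set.mem_ofPred_eq]
      exact ⟨hc, ⟨hcb ▸ hb.1.1, hcj⟩, hcb ▸ hba⟩
    -- An up arrow `b` in a later box must be taken from the right of `a`: otherwise the greedy rule
    -- would match `a` at or before `b`, inside the interval.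
    have e5 : (Finset.univ.filter fun v : Vertex d => ((box a).succ ≤ (box v).castSucc ∧
        (box v).castSucc < j) ∧ ¬ IsDown w v).card ≤
        (M.filter fun c => (i ≤ (box c.1).castSucc ∧ (box c.2).castSucc < j) ∧
        ¬ box c.1 < box a).card := by
      refine Finset.card_le_card_of_surjOn Prod.snd ?_
      intro b hb
      simp only [Finset.coe_filter, Finset.mem_univ, true_and, Set.mem_ofPred_eq] at hb
      obtain ⟨⟨hab, hbj⟩, hub⟩ := hb
      have hab' : box a < box b := hab
      obtain ⟨c, hc, h1 | h1⟩ := h.greedy a hda b hub (lt_of_box_lt hab')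
      · exact absurd (lt_of_le_of_lt (Fin.castSucc_le_castSucc_iff.2 (box_mono h1.2)) hbj)
          (hua c hc h1.1)
      · refine ⟨c, ?_, h1.1⟩
        have h2 := box_mono h1.2.le
        simp only [Finset.coe_filter, Set.mem_ofPred_eq]
        exact ⟨hc, ⟨hia.trans (Fin.castSucc_le_castSucc_iff.2 h2), h1.1 ▸ hbj⟩, not_lt.2 h2⟩
    omega

lemma partialSum_card_filter (f : Vertex d × Vertex d → Fin k) (M : Finset (Vertex d × Vertex d))
    (j : Fin (k + 1)) :
    partialSum (fun i => (M.filter fun c => f c = i).card) j =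
      (M.filter fun c => (f c).castSucc < j).card := by
  rw [partialSum, Finset.card_eq_sum_card_fiberwise (f := f)
    (t := Finset.univ.filter fun i : Fin k => i.castSucc < j)]
  · refine Finset.sum_congr rfl fun i hi => ?_
    rw [Finset.filter_filter]
    congr 1
    ext c
    simp only [Finset.mem_filter, Finset.mem_univ, true_and] at hi ⊢
    constructor
    · rintro ⟨h1, rfl⟩
      exact ⟨h1, hi, rfl⟩
    · rintro ⟨h1, -, h2⟩
      exact ⟨h1, h2⟩
  · intro c hc
    simpa using (Finset.mem_filter.1 hc).2

/-- A curve starts either before `j` or at or after it; the latter are counted by `arcCount M j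
(Fin.last k)`. -/
lemma partialSum_rVec (M : Finset (Vertex d × Vertex d)) (j : Fin (k + 1)) :
    partialSum (rVec M) j + arcCount M j (Fin.last k) = arcCount M 0 (Fin.last k) := by
  have h := partialSum_card_filter (fun c => box c.1) M j
  have h2 := Finset.card_filter_add_card_filter_not (s := M) (fun c => (box c.1).castSucc < j)
  simp only [not_lt] at h2
  simp only [arcCount, Fin.castSucc_lt_last, and_true, Fin.zero_le, Finset.filter_true]
  rw [← h2, ← h]
  rfl

lemma IsGreedy.partialSum_nVec {M : Finset (Vertex d × Vertex d)}
    (h : IsGreedy w {a | IsDown w a} M) (j : Fin (k + 1)) :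
    partialSum (nVec M) j + arcCount M 0 j = partialSum d j := by
  have h1 := partialSum_card_filter (fun c => box c.2) M j
  -- Right endpoints are distinct, so the natural subtraction in `nVec` does not truncate.
  have h2 : ∀ i, (M.filter fun c => box c.2 = i).card ≤ d i := by
    intro i
    calc (M.filter fun c => box c.2 = i).card
        ≤ (Finset.univ.filter fun v : Vertex d => box v = i ∧ True).card := by
          refine Finset.card_le_card_of_injOn Prod.snd ?_ ?_
          · intro c hc
            simpa using (Finset.mem_filter.1 hc).2
          · intro c hc c' hc' e
            exact h.snd_inj c (Finset.mem_filter.1 hc).1 c' (Finset.mem_filter.1 hc').1 e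
      _ = d i := by
          have := card_filter_box (d := d) (fun i a => True) (fun l => l = i)
          rw [this]
          simp [Finset.sum_filter]
  simp only [arcCount, Fin.zero_le, true_and]
  rw [← h1]
  exact partialSum_sub h2 j

end Match

open Module

/-! ### Adapted bases -/

section Adapted

variable {K D : Type*} [Field K] [AddCommGroup D] [Module K D] {k : ℕ} {d : Fin k → ℕ}

section Basis

variable {b : Basis (Σ i : Fin k, Fin (d i)) K D} {w : Fin k → ℕ}
  {F : Fin (k + 1) → Submodule K D} {W : Submodule K D}

lemma IsAdapted.mem_flag (h : IsAdapted b w F W) {j : Fin (k + 1)} {y : D} :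
    y ∈ F j ↔ ∀ v, b.repr y v ≠ 0 → v.1.castSucc < j := by
  rw [h.flag_eq, b.mem_span_image]
  simp [Set.subset_def]

lemma IsAdapted.mem_W (h : IsAdapted b w F W) {y : D} :
    y ∈ W ↔ ∀ v, b.repr y v ≠ 0 → (v.2 : ℕ) < w v.1 := by
  rw [h.W_eq, b.mem_span_image]
  simp [Set.subset_def]

lemma IsAdapted.apply_mem_flag (h : IsAdapted b w F W) {j : Fin (k + 1)}
    {v : Σ i : Fin k, Fin (d i)} (hv : v.1.castSucc < j) : b v ∈ F j := by
  rw [h.flag_eq]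
  exact Submodule.subset_span ⟨v, hv, rfl⟩

lemma IsAdapted.apply_mem_W (h : IsAdapted b w F W) {v : Σ i : Fin k, Fin (d i)}
    (hv : (v.2 : ℕ) < w v.1) : b v ∈ W := by
  rw [h.W_eq]
  exact Submodule.subset_span ⟨v, hv, rfl⟩

end Basis

/-- Reading off the row coordinates of the block gives a projection `π`. It maps `t 𝐃_{q+1}` onto
the column span, and its kernel there is the intersection with `𝐃_p`; so the rank is `dim (t 𝐃_{q+1}
+ 𝐃_p) / 𝐃_p`. -/
lemma rank_blockMatrix [FiniteDimensional K D] {x : TensorVariety K D d}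
    {b : Basis (Σ i : Fin k, Fin (d i)) K D} {w : Fin k → ℕ} (h : IsAdapted b w x.flag x.W)
    (p q : Fin k) :
    (blockMatrix b w x.t p q).rank + partialSum d p.castSucc =
      x.imageDim p.castSucc q.succ := by
  let π : D →ₗ[K] ({v : Σ i : Fin k, Fin (d i) // p ≤ v.1 ∧ v.1 < q ∧ (v.2 : ℕ) < w v.1} → K) :=
    LinearMap.funLeft K K Subtype.val ∘ₗ b.equivFun.toLinearMap
  have hπ : ∀ y v, π y v = b.repr y v.1 := fun y v => rfl
  have hcol : ∀ u, (blockMatrix b w x.t p q).col u = π (x.t (b u.1)) := by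
    intro u
    ext v
    simp [blockMatrix, LinearMap.toMatrix_apply, hπ]
  have hπ0 : ∀ y ∈ x.flag p.castSucc, π y = 0 := by
    intro y hy
    ext v
    by_contra hv
    exact absurd (h.mem_flag.1 hy v.1 hv) (not_lt.2 (Fin.castSucc_le_castSucc_iff.2 v.2.1))
  have hspan : Submodule.span K (Set.range (blockMatrix b w x.t p q).col) =
      ((x.flag q.succ).map x.t).map π := by
    apply le_antisymm
    · rw [Submodule.span_le]
      rintro _ ⟨u, rfl⟩
      rw [hcol]
      exact ⟨_, ⟨_, h.apply_mem_flag (Fin.castSucc_lt_succ_iff.2 u.2.2.1), rfl⟩, rfl⟩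
    · rw [h.flag_eq, Submodule.map_span, Submodule.map_span, Submodule.span_le]
      rintro _ ⟨_, ⟨_, ⟨u, hu, rfl⟩, rfl⟩, rfl⟩
      -- Basis vectors outside the columns of the block contribute nothing: those of groups up to
      -- `p` are sent into `𝐃_p`, where `π` vanishes, and those in `W` are killed by `t`.
      by_cases hup : u.1 ≤ p
      · rw [hπ0 _ (x.t_flag p ⟨_, h.apply_mem_flag (Fin.castSucc_lt_succ_iff.2 hup), rfl⟩)]
        exact zero_mem _
      by_cases huw : (u.2 : ℕ) < w u.1
      · rw [LinearMap.mem_ker.1 (x.le_ker (h.apply_mem_W huw)), map_zero]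
        exact zero_mem _
      · rw [← hcol ⟨u, not_le.1 hup, Fin.castSucc_lt_succ_iff.1 hu, not_lt.1 huw⟩]
        exact Submodule.subset_span ⟨_, rfl⟩
  have hker : (LinearMap.ker π ⊓ (x.flag q.succ).map x.t : Submodule K D) =
      (x.flag q.succ).map x.t ⊓ x.flag p.castSucc := by
    ext y
    simp only [Submodule.mem_inf]
    -- A vector of `t 𝐃_{q+1}` lies in `W ∩ 𝐃_q`, so its only coordinates outside `𝐃_p` are those
    -- seen by `π`.
    refine ⟨fun ⟨h1, h2⟩ => ⟨h2, h.mem_flag.2 fun v hv => ?_⟩, fun ⟨h1, h2⟩ => ⟨hπ0 y h2, h1⟩⟩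
    by_contra hpv
    have h3 := h.mem_W.1 (x.map_flag_le_W _ h2) v hv
    have h4 := h.mem_flag.1 (x.t_flag q h2) v hv
    exact hv (congr_fun (LinearMap.mem_ker.1 h1)
      ⟨v, Fin.castSucc_le_castSucc_iff.1 (not_lt.1 hpv), h4, h3⟩)
  have h1 := finrank_map_add_finrank_ker_inf π ((x.flag q.succ).map x.t)
  have h2 := Submodule.finrank_sup_add_finrank_inf_eq ((x.flag q.succ).map x.t)
    (x.flag p.castSucc)
  rw [hker] at h1
  rw [x.finrank_flag] at h2
  rw [Matrix.rank_eq_finrank_span_cols, hspan, TensorVariety.imageDim]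
  omega

lemma exists_family_of_relDim [FiniteDimensional K D] (A B : Submodule K D) :
    ∃ f : Fin (relDim A B) → D, (∀ a, f a ∈ B) ∧ B ≤ A ⊔ Submodule.span K (Set.range f) := by
  let e := finBasis K (B ⧸ A.submoduleOf B)
  choose g hg using fun a => (A.submoduleOf B).mkQ_surjective (e a)
  refine ⟨fun a => g a, fun a => (g a).2, fun y hy => ?_⟩
  obtain ⟨r, hr⟩ : ∃ r : Fin (finrank K (B ⧸ A.submoduleOf B)) → K,
      ∑ a, r a • e a = (A.submoduleOf B).mkQ ⟨y, hy⟩ := ⟨_, e.sum_repr _⟩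
  have h1 : (⟨y, hy⟩ : B) - ∑ a, r a • g a ∈ A.submoduleOf B := by
    refine (Submodule.Quotient.mk_eq_zero _).1 ?_
    rw [← Submodule.mkQ_apply, map_sub, map_sum]
    simp only [map_smul, hg]
    rw [hr, sub_self]
  have h2 : y - ∑ a, r a • (g a : D) ∈ A := by
    simpa [Submodule.submoduleOf] using h1
  rw [← sub_add_cancel y (∑ a, r a • (g a : D))]
  refine Submodule.add_mem_sup h2 (Submodule.sum_mem _ fun a _ => ?_)
  exact Submodule.smul_mem _ _ (Submodule.subset_span ⟨a, rfl⟩)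

/-- One step of an adapted basis. -/
lemma exists_adapted_step [FiniteDimensional K D] {A B W : Submodule K D} (h : A ≤ B) {n m : ℕ}
    (hm : relDim (W ⊓ A) (W ⊓ B) = m) (hn : relDim A B = n) :
    ∃ f : Fin n → D, (∀ a, f a ∈ B) ∧ (∀ a : Fin n, (a : ℕ) < m → f a ∈ W) ∧
      B ≤ A ⊔ Submodule.span K (Set.range f) ∧
      W ⊓ B ≤ (W ⊓ A) ⊔ Submodule.span K (f '' {a : Fin n | (a : ℕ) < m}) := by
  subst hm hn
  have hWAB : W ⊓ A ≤ W ⊓ B := inf_le_inf_left W h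
  have hAB : A ⊔ (W ⊓ B) ≤ B := sup_le h inf_le_right
  obtain ⟨f, hf, hf'⟩ := exists_family_of_relDim (W ⊓ A) (W ⊓ B)
  obtain ⟨g, hg, hg'⟩ := exists_family_of_relDim (A ⊔ (W ⊓ B)) B
  have h1 := relDim_add_finrank hWAB
  have h2 := relDim_add_finrank hAB
  have h3 := relDim_add_finrank h
  have h4 := Submodule.finrank_sup_add_finrank_inf_eq A (W ⊓ B)
  rw [inf_left_comm, inf_eq_left.2 h] at h4
  -- `(A + (W ∩ B)) / A` is isomorphic to `(W ∩ B) / (W ∩ A)`, so lifts of bases of this quotient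
  -- and of `B / (A + (W ∩ B))` have the right total number.
  have hlen : relDim A B = relDim (W ⊓ A) (W ⊓ B) + relDim (A ⊔ (W ⊓ B)) B := by omega
  have hF := Fin.append_left f g
  have hG := Fin.append_right f g
  generalize relDim (W ⊓ A) (W ⊓ B) = m at *
  generalize relDim (A ⊔ (W ⊓ B)) B = l at *
  rw [hlen]
  have hfspan : W ⊓ B ≤ (W ⊓ A) ⊔ Submodule.span K 
        (Fin.append f g '' {a : Fin (m + l) | (a : ℕ) < m}) := by
    refine hf'.trans (sup_le_sup_left (Submodule.span_mono ?_) _)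
    rintro _ ⟨a, rfl⟩
    exact ⟨Fin.castAdd l a, a.2, hF a⟩
  refine ⟨Fin.append f g, ?_, ?_, ?_, hfspan⟩
  · intro a
    induction a using Fin.addCases with
    | left a => rw [hF]; exact (hf a).2
    | right a => rw [hG]; exact hg a
  · intro a ha
    induction a using Fin.addCases with
    | left a => rw [hF]; exact (hf a).1
    | right a => simp at ha
  · refine hg'.trans (sup_le (sup_le le_sup_left (hfspan.trans ?_)) ?_)
    · exact sup_le_sup inf_le_right (Submodule.span_mono (Set.image_subset_range _ _))
    · refine le_sup_of_le_right (Submodule.span_mono ?_)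
      rintro _ ⟨a, rfl⟩
      exact ⟨Fin.natAdd m a, hG a⟩

/-- The families chosen at the successive steps together span `D` and number `dim D`, hence form a
basis. -/
lemma exists_isAdapted [FiniteDimensional K D] {w : Fin k → ℕ}
    {x : TensorVariety K D d} (hx : x ∈ Z K D d w) :
    ∃ b : Basis (Σ i : Fin k, Fin (d i)) K D, IsAdapted b w x.flag x.W := by
  have hstep := fun i : Fin k => exists_adapted_step (x.flag_le i) (W := x.W)
    (congr_fun hx i) (x.flag_dim i)
  choose f hfB hfW hf hf' using hstep
  let c : (Σ i : Fin k, Fin (d i)) → D := fun v => f v.1 v.2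
  have hflag : ∀ j, x.flag j = Submodule.span K (c '' {v | v.1.castSucc < j}) := by
    intro j
    apply le_antisymm
    · induction j using Fin.induction with
      | zero => simp [x.flag_zero]
      | succ i ih =>
        refine (hf i).trans (sup_le (ih.trans (Submodule.span_mono (Set.image_mono ?_)))
          (Submodule.span_mono ?_))
        · exact fun v hv => lt_trans hv Fin.castSucc_lt_succ
        · rintro _ ⟨a, rfl⟩
          exact ⟨⟨i, a⟩, Fin.castSucc_lt_succ, rfl⟩
    · rw [Submodule.span_le]
      rintro _ ⟨v, hv, rfl⟩
      exact x.monotone_flag (show v.1.succ ≤ j from (show v.1.castSucc < j from hv)) (hfB v.1 v.2)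
  have hW : x.W = Submodule.span K (c '' {v | (v.2 : ℕ) < w v.1}) := by
    apply le_antisymm
    · have : ∀ j, x.W ⊓ x.flag j ≤ Submodule.span K (c '' {v | (v.2 : ℕ) < w v.1}) := by
        intro j
        induction j using Fin.induction with
        | zero => simp [x.flag_zero]
        | succ i ih =>
          refine (hf' i).trans (sup_le ih (Submodule.span_mono ?_))
          rintro _ ⟨a, ha, rfl⟩
          exact ⟨⟨i, a⟩, ha, rfl⟩
      simpa [x.flag_last] using this (Fin.last k)
    · rw [Submodule.span_le]
      rintro _ ⟨v, hv, rfl⟩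
      exact hfW v.1 v.2 hv
  have htop : ⊤ ≤ Submodule.span K (Set.range c) := by
    rw [← x.flag_last, hflag]
    exact Submodule.span_mono (Set.image_subset_range _ _)
  have hcard : Fintype.card (Σ i : Fin k, Fin (d i)) = finrank K D := by
    rw [← finrank_top K D, ← x.flag_last, x.finrank_flag, partialSum_last]
    simp
  let b := Basis.mk (linearIndependent_of_top_le_span_of_card_eq_finrank htop hcard) htop
  have hb : (b : (Σ i : Fin k, Fin (d i)) → D) = c := Basis.coe_mk _ _
  exact ⟨b, fun j => by rw [hb]; exact hflag j, by rw [hb]; exact hW⟩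

end Adapted

/-! ### The partial permutation of the match -/

section MatchMap

variable {K D : Type*} [Field K] [AddCommGroup D] [Module K D] {k : ℕ} {d : Fin k → ℕ}

/-- The basis vector at a vertex; adapted bases have the vectors in `W` first, while down arrows
come last in a box. -/
def basisIndex (v : Vertex d) : Σ i : Fin k, Fin (d i) :=
  ⟨(ofLex v).1, (ofLex v).2.rev⟩

lemma basisIndex_injective : Function.Injective (basisIndex (d := d)) := by
  rintro ⟨i, a⟩ ⟨j, b⟩ h
  simp only [basisIndex, Sigma.mk.injEq] at h
  obtain ⟨h1, h2⟩ := h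
  change i = j at h1
  subst h1
  exact congrArg (Sigma.mk i) (Fin.rev_injective (eq_of_heq h2))

lemma basisIndex_lt_iff (w : Fin k → ℕ) (v : Vertex d) :
    ((basisIndex v).2 : ℕ) < w (basisIndex v).1 ↔ IsDown w v := by
  obtain ⟨i, a⟩ := v
  change (a.rev : ℕ) < w i ↔ d i ≤ (a : ℕ) + w i
  have := a.2
  rw [Fin.val_rev]
  omega

/-- The map taking the basis vector of the right endpoint of each curve to the basis vector of
its left endpoint. -/
noncomputable def matchMap (b : Basis (Σ i : Fin k, Fin (d i)) K D)
    (M : Finset (Vertex d × Vertex d)) : D →ₗ[K] D :=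
  b.constr K fun u => ∑ c ∈ M with basisIndex c.2 = u, b (basisIndex c.1)

lemma matchMap_mem {b : Basis (Σ i : Fin k, Fin (d i)) K D} {M : Finset (Vertex d × Vertex d)}
    {S : Submodule K D} {u : Σ i : Fin k, Fin (d i)}
    (h : ∀ c ∈ M, basisIndex c.2 = u → b (basisIndex c.1) ∈ S) : matchMap b M (b u) ∈ S := by
  rw [matchMap, Basis.constr_basis]
  refine Submodule.sum_mem _ fun c hc => ?_
  obtain ⟨h1, h2⟩ := Finset.mem_filter.1 hc
  exact h c h1 h2

variable {w : Fin k → ℕ} {M : Finset (Vertex d × Vertex d)}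

lemma IsGreedy.matchMap_apply (hM : IsGreedy w {a | IsDown w a} M)
    (b : Basis (Σ i : Fin k, Fin (d i)) K D) {c : Vertex d × Vertex d} (hc : c ∈ M) :
    matchMap b M (b (basisIndex c.2)) = b (basisIndex c.1) := by
  rw [matchMap, Basis.constr_basis]
  refine Finset.sum_eq_single_of_mem c (Finset.mem_filter.2 ⟨hc, rfl⟩) fun c' hc' hne => ?_
  obtain ⟨h1, h2⟩ := Finset.mem_filter.1 hc'
  exact absurd (hM.snd_inj c' h1 c hc (basisIndex_injective h2)) hne

/-- The point of the tensor product variety over `(𝐃, W)` given by the match. -/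
noncomputable def IsGreedy.matchPoint (hM : IsGreedy w {a | IsDown w a} M) (x : TensorVariety K D d)
    {b : Basis (Σ i : Fin k, Fin (d i)) K D} (hb : IsAdapted b w x.flag x.W) :
    TensorVariety K D d where
  flag := x.flag
  W := x.W
  t := matchMap b M
  flag_zero := x.flag_zero
  flag_last := x.flag_last
  flag_le := x.flag_le
  flag_dim := x.flag_dim
  t_flag := by
    intro i
    conv_lhs => rw [hb.flag_eq]
    rw [Submodule.map_span, Submodule.span_le]
    rintro _ ⟨_, ⟨u, hu, rfl⟩, rfl⟩
    refine matchMap_mem fun c hc hcu => hb.apply_mem_flag ?_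
    subst hcu
    exact Fin.castSucc_lt_castSucc_iff.2 (lt_of_lt_of_le (hM.box_lt hc)
      (Fin.castSucc_lt_succ_iff.1 hu))
  range_le := by
    rw [LinearMap.range_eq_map, ← b.span_eq, Submodule.map_span, Submodule.span_le]
    rintro _ ⟨_, ⟨u, rfl⟩, rfl⟩
    exact matchMap_mem fun c hc _ =>
      hb.apply_mem_W ((basisIndex_lt_iff w c.1).2 (hM.fst_mem c hc))
  le_ker := by
    rw [hb.W_eq, Submodule.span_le]
    rintro _ ⟨u, hu, rfl⟩
    rw [SetLike.mem_coe, LinearMap.mem_ker, ← Submodule.mem_bot K]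
    refine matchMap_mem fun c hc hcu => ?_
    subst hcu
    exact absurd ((basisIndex_lt_iff w c.2).1 hu) (hM.not_isDown c hc)

/-- The basis vectors at the left endpoints of the curves inside the interval lie in `t 𝐃_j`; they
are distinct from one another and from the basis vectors spanning `𝐃_i`. -/
lemma IsGreedy.le_imageDim_matchPoint [FiniteDimensional K D]
    (hM : IsGreedy w {a | IsDown w a} M) (x : TensorVariety K D d)
    {b : Basis (Σ i : Fin k, Fin (d i)) K D} (hb : IsAdapted b w x.flag x.W)
    (i j : Fin (k + 1)) :
    arcCount M i j + partialSum d i ≤ (hM.matchPoint x hb).imageDim i j := by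
  classical
  let s : Finset (Vertex d) :=
    (M.filter fun c => i ≤ (box c.1).castSucc ∧ (box c.2).castSucc < j).image Prod.fst
  let r : Finset (Vertex d) := Finset.univ.filter fun v => (box v).castSucc < i
  have hs : s.card = arcCount M i j := by
    refine Finset.card_image_of_injOn fun c hc c' hc' e => ?_
    exact hM.fst_inj c (Finset.mem_filter.1 hc).1 c' (Finset.mem_filter.1 hc').1 e
  have hr : r.card = partialSum d i := card_vertex i
  have hdisj : Disjoint s r := by
    rw [Finset.disjoint_left]
    intro v hv hv'
    obtain ⟨c, hc, rfl⟩ := Finset.mem_image.1 hv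
    exact absurd (Finset.mem_filter.1 hc).2.1 (not_le.2 (Finset.mem_filter.1 hv').2)
  have hli : LinearIndependent K fun v : (s ∪ r : Finset (Vertex d)) => b (basisIndex v.1) :=
    b.linearIndependent.comp _ (basisIndex_injective.comp Subtype.val_injective)
  rw [← hs, ← hr, ← Finset.card_union_of_disjoint hdisj, ← Fintype.card_coe,
    ← finrank_span_eq_card hli, TensorVariety.imageDim]
  apply Submodule.finrank_mono
  rw [Submodule.span_le]
  rintro _ ⟨⟨v, hv⟩, rfl⟩
  rcases Finset.mem_union.1 hv with hv | hv
  · obtain ⟨c, hc, rfl⟩ := Finset.mem_image.1 hv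
    obtain ⟨h1, -, h2⟩ := Finset.mem_filter.1 hc
    refine Submodule.mem_sup_left ⟨b (basisIndex c.2), hb.apply_mem_flag h2, ?_⟩
    exact hM.matchMap_apply b h1
  · exact Submodule.mem_sup_right (hb.apply_mem_flag (Finset.mem_filter.1 hv).2)

variable [FiniteDimensional K D]

lemma IsGreedy.imageDim_le (hM : IsGreedy w {a | IsDown w a} M) (hw : ∀ i, w i ≤ d i)
    {x : TensorVariety K D d} (hx : x ∈ Z K D d w) {i j : Fin (k + 1)} (hij : i ≤ j) :
    x.imageDim i j ≤ arcCount M i j + partialSum d i := by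
  rcases hM.le_arcCount hw hij with h | ⟨s, his, hsj, h⟩
  · have := x.imageDim_le_rows hx hij
    omega
  · have := x.imageDim_le_rows_add_cols hx hw his hsj
    omega

/-- The curve count bounds the rank over every point above `(𝐃, W)`, and `matchPoint` is a
competitor that attains it. -/
lemma IsGreedy.hasMaxRank_iff (hM : IsGreedy w {a | IsDown w a} M) (hw : ∀ i, w i ≤ d i)
    {x : TensorVariety K D d} (hx : x ∈ Z K D d w)
    {b : Basis (Σ i : Fin k, Fin (d i)) K D} (hb : IsAdapted b w x.flag x.W)
    {p q : Fin k} (hpq : p < q) :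
    HasMaxRank x b w p q ↔
      arcCount M p.castSucc q.succ + partialSum d p.castSucc ≤
        x.imageDim p.castSucc q.succ := by
  have hle : p.castSucc ≤ q.succ := (Fin.castSucc_lt_succ_iff.2 hpq.le).le
  have hxr := rank_blockMatrix hb p q
  constructor
  · intro h
    have h1 := h (hM.matchPoint x hb) rfl rfl
    have h2 := rank_blockMatrix (x := hM.matchPoint x hb) hb p q
    have h3 := hM.le_imageDim_matchPoint x hb p.castSucc q.succ
    omega
  · intro h y hyF hyW
    have hy : y ∈ Z K D d w := by
      change alpha y.W y.flag = w
      rw [hyF, hyW]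
      exact hx
    have h1 := hM.imageDim_le hw hy hle
    have h2 := rank_blockMatrix (x := y) (hyF ▸ hyW ▸ hb) p q
    omega

/-- Rank-nullity on `𝐃_j` converts `ker t ∩ 𝐃_j` into `imageDim 0 j`, and the modular law converts
`im t ∩ 𝐃_i` into `imageDim i k`. By the upper bound, the inequalities here are equalities. -/
lemma IsGreedy.mem_A_iff (hM : IsGreedy w {a | IsDown w a} M) (hw : ∀ i, w i ≤ d i)
    {x : TensorVariety K D d} :
    x ∈ A K D d w (rVec M) (nVec M) ↔ x ∈ Z K D d w ∧ ∀ i j, i = 0 ∨ j = Fin.last k →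
      arcCount M i j + partialSum d i ≤ x.imageDim i j := by
  change (x ∈ Z K D d w ∧ _ ∧ _) ↔ _
  refine and_congr_right fun hx => ?_
  rw [alpha_eq_iff x.flag_zero x.flag_le, alpha_eq_iff x.flag_zero x.flag_le]
  have hup : ∀ i j, i = 0 ∨ j = Fin.last k →
      x.imageDim i j ≤ arcCount M i j + partialSum d i := by
    rintro i j (rfl | rfl)
    · exact hM.imageDim_le hw hx (Fin.zero_le j)
    · exact hM.imageDim_le hw hx (Fin.le_last i)
  have h0 : ∀ j, x.imageDim 0 j +
      finrank K (LinearMap.ker x.t ⊓ x.flag j : Submodule K D) = partialSum d j := by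
    intro j
    have h := finrank_map_add_finrank_ker_inf x.t (x.flag j)
    rwa [x.finrank_flag, ← sup_bot_eq ((x.flag j).map x.t), ← x.flag_zero] at h
  have hl : ∀ i, x.imageDim i (Fin.last k) +
      finrank K (LinearMap.range x.t ⊓ x.flag i : Submodule K D) =
      x.imageDim 0 (Fin.last k) + partialSum d i := by
    intro i
    have h := Submodule.finrank_sup_add_finrank_inf_eq (LinearMap.range x.t) (x.flag i)
    rw [x.finrank_flag] at h
    rw [TensorVariety.imageDim, TensorVariety.imageDim, x.flag_zero, sup_bot_eq, x.flag_last,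
      ← LinearMap.range_eq_map, h]
  constructor
  · rintro ⟨hr, hn⟩
    have h1 : ∀ j, arcCount M 0 j ≤ x.imageDim 0 j := by
      intro j
      have := h0 j
      have := hn j
      have := hM.partialSum_nVec j
      omega
    rintro i j (rfl | rfl)
    · simpa using h1 j
    · have := h1 (Fin.last k)
      have := hl i
      have := hr i
      have := partialSum_rVec M i
      omega
  · intro h
    have h1 : ∀ j, x.imageDim 0 j = arcCount M 0 j := by
      intro j
      simpa using le_antisymm (hup 0 j (Or.inl rfl)) (h 0 j (Or.inl rfl))
    refine ⟨fun i => ?_, fun j => ?_⟩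
    · have := h1 (Fin.last k)
      have := hl i
      have := le_antisymm (hup i _ (Or.inr rfl)) (h i _ (Or.inr rfl))
      have := partialSum_rVec M i
      omega
    · have := h0 j
      have := h1 j
      have := hM.partialSum_nVec j
      omega

lemma TensorVariety.partialSum_le_imageDim (x : TensorVariety K D d) (i j : Fin (k + 1)) :
    partialSum d i ≤ x.imageDim i j := by
  rw [← x.finrank_flag]
  exact Submodule.finrank_mono le_sup_right

lemma IsGreedy.mem_A_iff_hasMaxRank (hM : IsGreedy w {a | IsDown w a} M) (hw : ∀ i, w i ≤ d i)
    {x : TensorVariety K D d} (hx : x ∈ Z K D d w)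
    {b : Basis (Σ i : Fin k, Fin (d i)) K D} (hb : IsAdapted b w x.flag x.W) :
    x ∈ A K D d w (rVec M) (nVec M) ↔
      ∀ p q : Fin k, p < q → ((p : ℕ) = 0 ∨ (q : ℕ) + 1 = k) → HasMaxRank x b w p q := by
  rw [hM.mem_A_iff hw, and_iff_right hx]
  constructor
  · intro h p q hpq hpq'
    rw [hM.hasMaxRank_iff hw hx hb hpq]
    refine h _ _ (hpq'.imp (fun h => ?_) fun h => ?_)
    · exact Fin.ext h
    · exact Fin.ext h
  · intro h i j hij
    -- Pairs that do not come from some `p < q` contain no curve, because a curve joins two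
    -- different boxes; for them the condition is void.
    rcases Nat.eq_zero_or_pos (arcCount M i j) with h0 | h0
    · rw [h0, zero_add]
      exact x.partialSum_le_imageDim i j
    · obtain ⟨c, hc⟩ := Finset.card_pos.1 h0
      obtain ⟨hcM, hi, hj⟩ := Finset.mem_filter.1 hc
      have hlt := hM.box_lt hcM
      obtain ⟨p, rfl⟩ := Fin.exists_castSucc_eq.2 (hi.trans_lt (Fin.castSucc_lt_last _)).ne
      obtain ⟨q, rfl⟩ := Fin.exists_succ_eq.2 ((Fin.zero_le _).trans_lt hj).ne'
      have hpq : p < q := (Fin.castSucc_le_castSucc_iff.1 hi).trans_lt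
        (hlt.trans_le (Fin.castSucc_lt_succ_iff.1 hj))
      rw [← hM.hasMaxRank_iff hw hx hb hpq]
      refine h p q hpq (hij.imp (fun h => ?_) fun h => ?_)
      · exact congrArg Fin.val h
      · exact congrArg Fin.val h

end MatchMap

open scoped Topology

/-! ### Zariski openness of rank conditions -/

section Zariski

variable {K V E : Type*} [Field K] [AddCommGroup V] [Module K V] [AddCommGroup E] [Module K E]

lemma dual_mem_polyFun (φ : Dual K V) : (fun v => φ v) ∈ polyFun K V :=
  Algebra.subset_adjoin ⟨φ, rfl⟩

lemma isOpen_zariski_of_polyFun {f : V → K} (hf : f ∈ polyFun K V) :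
    IsOpen[zariski K V] {v | f v ≠ 0} :=
  TopologicalSpace.isOpen_generateFrom_of_mem ⟨f, hf, rfl⟩

/-- A map of vector spaces all of whose coordinates are polynomial functions. -/
def IsPolyMap (K : Type*) {V E : Type*} [Field K] [AddCommGroup V] [Module K V] [AddCommGroup E]
    [Module K E] (g : V → E) : Prop :=
  ∀ φ : Dual K E, (fun v => φ (g v)) ∈ polyFun K V

lemma IsPolyMap.of_linearMap (g : V →ₗ[K] E) : IsPolyMap K g :=
  fun φ => dual_mem_polyFun (φ ∘ₗ g)

/-- A coordinate-free form of nonvanishing minors: for independent vectors, the coordinates of a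
left inverse are linear forms giving the identity matrix. -/
lemma le_finrank_span_iff [FiniteDimensional K E] {ι : Type*} [Finite ι] (y : ι → E) (N : ℕ) :
    N ≤ finrank K (Submodule.span K (Set.range y)) ↔
      ∃ (h : Fin N → ι) (φ : Fin N → Dual K E),
        (Matrix.of fun a c => φ c (y (h a))).det ≠ 0 := by
  constructor
  · intro hN
    obtain ⟨f, hf, -, hli⟩ := Submodule.exists_fun_fin_finrank_span_eq K (Set.range y)
    choose h hh using hf
    have hli' : LinearIndependent K fun a : Fin N => y (h (Fin.castLE hN a)) := by
      simp only [hh]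
      exact hli.comp _ (Fin.castLE_injective hN)
    obtain ⟨g, hg⟩ := LinearMap.exists_leftInverse_of_injective
      (Fintype.linearCombination K fun a : Fin N => y (h (Fin.castLE hN a)))
      (LinearMap.ker_eq_bot.2 (hli'.fintypeLinearCombination_injective))
    refine ⟨fun a => h (Fin.castLE hN a), fun c => LinearMap.proj c ∘ₗ g, ?_⟩
    have h1 : (Matrix.of fun a c => (LinearMap.proj c ∘ₗ g : Dual K E)
        (y (h (Fin.castLE hN a)))) = (1 : Matrix (Fin N) (Fin N) K) := by
      ext a c
      have h2 := congr_fun (LinearMap.congr_fun hg (Pi.single a 1)) c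
      simp only [LinearMap.comp_apply, Fintype.linearCombination_apply_single, one_smul,
        LinearMap.id_apply] at h2
      simp only [Matrix.of_apply, LinearMap.comp_apply, LinearMap.proj_apply, h2,
        Matrix.one_apply, Pi.single_apply, eq_comm]
    rw [h1, Matrix.det_one]
    exact one_ne_zero
  · rintro ⟨h, φ, hdet⟩
    have h1 := Matrix.linearIndependent_rows_iff_isUnit.2
      ((Matrix.isUnit_iff_isUnit_det _).2 (isUnit_iff_ne_zero.2 hdet))
    have h2 : LinearIndependent K fun a => y (h a) :=
      LinearIndependent.of_comp (LinearMap.pi φ) h1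
    calc N = Fintype.card (Fin N) := (Fintype.card_fin N).symm
      _ = _ := (finrank_span_eq_card h2).symm
      _ ≤ _ := Submodule.finrank_mono (Submodule.span_mono (by rintro _ ⟨a, rfl⟩; exact ⟨_, rfl⟩))

lemma isOpen_le_finrank_span [FiniteDimensional K E] {ι : Type*} [Finite ι] {g : ι → V → E}
    (hg : ∀ i, IsPolyMap K (g i)) (N : ℕ) :
    IsOpen[zariski K V]
      {v | N ≤ finrank K (Submodule.span K (Set.range fun i => g i v))} := by
  let := zariski K V
  have h : {v | N ≤ finrank K (Submodule.span K (Set.range fun i => g i v))} =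
      ⋃ (h : Fin N → ι), ⋃ (φ : Fin N → Dual K E),
        {v | (Matrix.of fun a c => φ c (g (h a) v)).det ≠ 0} := by
    ext v
    simp only [Set.mem_iUnion]
    exact le_finrank_span_iff _ N
  rw [h]
  refine isOpen_iUnion fun h => isOpen_iUnion fun φ => ?_
  apply isOpen_zariski_of_polyFun
  have h1 : (fun v => (Matrix.of fun a c => φ c (g (h a) v)).det) =
      (Matrix.of fun a c => fun v => φ c (g (h a) v)).det := by
    ext v
    simp [Matrix.det_apply, Finset.sum_apply, Finset.prod_apply, Pi.smul_apply]
  rw [h1, Matrix.det_apply]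
  refine Subalgebra.sum_mem _ fun σ _ => ?_
  rw [Units.smul_def]
  exact zsmul_mem (Subalgebra.prod_mem _ fun a _ => hg _ _) _

/-- A polynomial function restricts to a polynomial on every line. -/
lemma exists_polynomial_of_polyFun {f : V → K} (hf : f ∈ polyFun K V) (u v : V) :
    ∃ P : Polynomial K, ∀ s, f (u + s • v) = P.eval s := by
  induction hf using Algebra.adjoin_induction with
  | mem f hf =>
    obtain ⟨φ, rfl⟩ := hf
    exact ⟨Polynomial.C (φ u) + Polynomial.X * Polynomial.C (φ v), fun s => by simp [mul_comm s]⟩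
  | algebraMap r => exact ⟨Polynomial.C r, fun s => by simp⟩
  | add f g _ _ hf hg =>
    obtain ⟨P, hP⟩ := hf
    obtain ⟨Q, hQ⟩ := hg
    exact ⟨P + Q, fun s => by simp [hP, hQ]⟩
  | mul f g _ _ hf hg =>
    obtain ⟨P, hP⟩ := hf
    obtain ⟨Q, hQ⟩ := hg
    exact ⟨P * Q, fun s => by simp [hP, hQ]⟩

/-- A Zariski open set that meets a line contains all but finitely many of its points. -/
lemma finite_compl_line {U : Set V} (hU : IsOpen[zariski K V] U) (u v : V) {s₀ : K}
    (h : u + s₀ • v ∈ U) : {s : K | u + s • v ∉ U}.Finite := by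
  induction hU with
  | basic U hU =>
    obtain ⟨f, hf, rfl⟩ := hU
    obtain ⟨P, hP⟩ := exists_polynomial_of_polyFun hf u v
    have hP0 : P ≠ 0 := by
      rintro rfl
      exact h (by simp [hP])
    refine (Polynomial.finite_setOfPred_isRoot hP0).subset fun s hs => ?_
    simpa [hP] using hs
  | univ => simp
  | inter U U' _ _ ih ih' =>
    refine ((ih h.1).union (ih' h.2)).subset fun s hs => ?_
    by_contra hs'
    simp only [Set.mem_union, not_or] at hs'
    exact hs ⟨not_not.1 hs'.1, not_not.1 hs'.2⟩
  | sUnion S _ ih =>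
    obtain ⟨U, hU, hu⟩ := h
    exact (ih U hU hu).subset fun s hs hs' => hs ⟨U, hU, hs'⟩

end Zariski

/-! ### Open loci of the tensor product variety -/

section Open

variable {K D : Type*} [Field K] [AddCommGroup D] [Module K D] {k : ℕ} {d : Fin k → ℕ}

lemma isOpen_iff_frames {U : Set (TensorVariety K D d)} :
    IsOpen U ↔ ∀ m, ∃ O, IsOpen[zariski K (FrameSpace K D d m)] O ∧
      ∀ (p : FrameSpace K D d m) x, IsFrame p x → (p ∈ O ↔ x ∈ U) := by
  refine isOpen_iSup_iff.trans (forall_congr' fun m => ?_)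
  rw [isOpen_coinduced]
  refine (@isOpen_induced_iff _ _ (zariski K _) _ _).trans (exists_congr fun O => and_congr_right fun _ => ?_)
  rw [Set.ext_iff]
  exact ⟨fun h p x hp => h ⟨(p, x), hp⟩, fun h q => h _ _ q.2⟩

lemma IsFrame.finrank_W {m : ℕ} {p : FrameSpace K D d m} {x : TensorVariety K D d}
    (h : IsFrame p x) : finrank K x.W = m := by
  rw [h.W_eq, finrank_span_eq_card h.linearIndependent_W, Fintype.card_fin]

lemma isPolyMap_flag_vector {m : ℕ} (v : Σ i : Fin k, Fin (d i)) :
    IsPolyMap K fun p : FrameSpace K D d m => p.1 v :=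
  .of_linearMap (V := FrameSpace K D d m) (LinearMap.proj v ∘ₗ LinearMap.fst K _ _)

lemma isPolyMap_W_vector {m : ℕ} (a : Fin m) :
    IsPolyMap K fun p : FrameSpace K D d m => p.2.1 a :=
  .of_linearMap (V := FrameSpace K D d m)
    (LinearMap.proj a ∘ₗ LinearMap.fst K _ _ ∘ₗ LinearMap.snd K _ _)

variable [FiniteDimensional K D]

/-- A locus is open if it is given, on frames, by a lower bound on the rank of a family of
vectors depending polynomially on the frame. -/
lemma isOpen_of_finrank_span {U : Set (TensorVariety K D d)}
    (h : ∀ m, ∃ (ι : Type) (_ : Finite ι) (g : ι → FrameSpace K D d m → D) (N : ℕ),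
      (∀ i, IsPolyMap K (g i)) ∧ ∀ (p : FrameSpace K D d m) x, IsFrame p x →
        (N ≤ finrank K (Submodule.span K (Set.range fun i => g i p)) ↔ x ∈ U)) : IsOpen U := by
  rw [isOpen_iff_frames]
  intro m
  obtain ⟨ι, _, g, N, hg, hU⟩ := h m
  exact ⟨_, isOpen_le_finrank_span hg N, hU⟩

/-- Evaluation is bilinear in the endomorphism and the vector; expanding the vector in a fixed basis
writes it as a sum of products of linear forms. -/
lemma isPolyMap_image_vector {m : ℕ} (v : Σ i : Fin k, Fin (d i)) :
    IsPolyMap K fun p : FrameSpace K D d m => p.2.2 (p.1 v) := by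
  intro φ
  let e := finBasis K D
  have h : (fun p : FrameSpace K D d m => φ (p.2.2 (p.1 v))) =
      ∑ a, (fun p : FrameSpace K D d m => e.coord a (p.1 v)) *
        fun p : FrameSpace K D d m => φ (p.2.2 (e a)) := by
    ext p
    conv_lhs => rw [← e.sum_repr (p.1 v), map_sum, map_sum]
    simp [Finset.sum_apply]
  rw [h]
  refine Subalgebra.sum_mem _ fun a _ => Subalgebra.mul_mem _ (isPolyMap_flag_vector v _) ?_
  exact IsPolyMap.of_linearMap (V := FrameSpace K D d m)
    (LinearMap.applyₗ (e a) ∘ₗ LinearMap.snd K _ _ ∘ₗ LinearMap.snd K _ _) φ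

lemma isOpen_le_imageDim (i j : Fin (k + 1)) (N : ℕ) :
    IsOpen {x : TensorVariety K D d | N ≤ x.imageDim i j} := by
  refine isOpen_of_finrank_span fun m => ⟨{v : Σ i : Fin k, Fin (d i) // v.1.castSucc < j} ⊕
    {v : Σ i : Fin k, Fin (d i) // v.1.castSucc < i}, inferInstance,
    Sum.elim (fun v p => p.2.2 (p.1 v.1)) (fun v p => p.1 v.1), N, ?_, fun p x hp => ?_⟩
  · rintro (v | v)
    · exact isPolyMap_image_vector _
    · exact isPolyMap_flag_vector _
  · have h : Submodule.span K (Set.range fun a : {v : Σ i : Fin k, Fin (d i) // v.1.castSucc < j} ⊕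
        {v : Σ i : Fin k, Fin (d i) // v.1.castSucc < i} => Sum.elim
        (fun v (p : FrameSpace K D d m) => p.2.2 (p.1 v.1)) (fun v p => p.1 v.1) a p) =
        (x.flag j).map x.t ⊔ x.flag i := by
      rw [hp.flag_eq, hp.flag_eq, hp.t_eq, Submodule.map_span, ← Submodule.span_union]
      congr 1
      ext y
      simp
    rw [h]
    rfl

/-- On frames with `dim W = m`, an upper bound on `dim (W ∩ 𝐃_j)` is a lower bound on `dim (W +
𝐃_j)`. Truncation of `m + dim 𝐃_j - N` at zero is harmless, since then both conditions always hold.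
-/
lemma isOpen_finrank_W_inf_le (j : Fin (k + 1)) (N : ℕ) :
    IsOpen {x : TensorVariety K D d | finrank K (x.W ⊓ x.flag j : Submodule K D) ≤ N} := by
  refine isOpen_of_finrank_span fun m => ⟨Fin m ⊕ {v : Σ i : Fin k, Fin (d i) // v.1.castSucc < j},
    inferInstance, Sum.elim (fun a p => p.2.1 a) (fun v p => p.1 v.1), m + partialSum d j - N, ?_,
    fun p x hp => ?_⟩
  · rintro (a | v)
    · exact isPolyMap_W_vector _
    · exact isPolyMap_flag_vector _
  · have h : Submodule.span K (Set.range fun a : Fin m ⊕ {v : Σ i : Fin k, Fin (d i) //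
        v.1.castSucc < j} => Sum.elim
        (fun a (p : FrameSpace K D d m) => p.2.1 a) (fun v p => p.1 v.1) a p) =
        x.W ⊔ x.flag j := by
      rw [hp.flag_eq, hp.W_eq, ← Submodule.span_union]
      congr 1
      ext y
      simp
    rw [h]
    have h1 := Submodule.finrank_sup_add_finrank_inf_eq x.W (x.flag j)
    rw [hp.finrank_W, x.finrank_flag] at h1
    change _ ↔ finrank K (x.W ⊓ x.flag j : Submodule K D) ≤ N
    omega

/-- Were the dimension smaller, an open neighbourhood of `x` would miss `Z`. -/
lemma finrank_W_inf_of_mem_closure {w : Fin k → ℕ} {x : TensorVariety K D d}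
    (hx : x ∈ closure (Z K D d w)) (j : Fin (k + 1)) :
    partialSum w j ≤ finrank K (x.W ⊓ x.flag j : Submodule K D) := by
  by_contra h
  obtain ⟨y, hy, hyZ⟩ := mem_closure_iff.1 hx _ (isOpen_finrank_W_inf_le j (partialSum w j - 1))
    (show finrank K (x.W ⊓ x.flag j : Submodule K D) ≤ _ by omega)
  have hy' : finrank K (y.W ⊓ y.flag j : Submodule K D) ≤ partialSum w j - 1 := hy
  rw [(alpha_eq_iff y.flag_zero y.flag_le y.W w).1 hyZ j] at hy'
  omega

variable {w : Fin k → ℕ} {M : Finset (Vertex d × Vertex d)}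

/-- On the closure of `Z` the dimensions of `W ∩ 𝐃_j` can only jump up, so the open conditions
bounding them above cut out `Z` itself; the rank conditions then cut out `A`. -/
lemma IsGreedy.exists_isOpen (hM : IsGreedy w {a | IsDown w a} M) (hw : ∀ i, w i ≤ d i) :
    ∃ U : Set (TensorVariety K D d), IsOpen U ∧
      A K D d w (rVec M) (nVec M) = U ∩ closure (Z K D d w) := by
  refine ⟨(⋂ j, {x | finrank K (x.W ⊓ x.flag j : Submodule K D) ≤ partialSum w j}) ∩
    ⋂ i, ⋂ j, ⋂ (_ : i = 0 ∨ j = Fin.last k),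
      {x | arcCount M i j + partialSum d i ≤ x.imageDim i j}, ?_, ?_⟩
  · refine (isOpen_iInter_of_finite fun j => isOpen_finrank_W_inf_le j _).inter
      (isOpen_iInter_of_finite fun i => isOpen_iInter_of_finite fun j =>
        isOpen_iInter_of_finite fun _ => isOpen_le_imageDim i j _)
  · ext x
    rw [hM.mem_A_iff hw]
    simp only [Set.mem_inter_iff, Set.mem_iInter]
    constructor
    · rintro ⟨hx, h⟩
      exact ⟨⟨fun j => ((alpha_eq_iff x.flag_zero x.flag_le x.W w).1 hx j).le, h⟩,
        subset_closure hx⟩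
    · rintro ⟨⟨h1, h2⟩, hx⟩
      exact ⟨(alpha_eq_iff x.flag_zero x.flag_le x.W w).2 fun j =>
        le_antisymm (h1 j) (finrank_W_inf_of_mem_closure hx j), h2⟩

/-- The points on the line through two points of the variety over the same `(𝐃, W)`. -/
def TensorVariety.line (x y : TensorVariety K D d) (hF : y.flag = x.flag) (hW : y.W = x.W)
    (s : K) : TensorVariety K D d where
  flag := x.flag
  W := x.W
  t := x.t + s • (y.t - x.t)
  flag_zero := x.flag_zero
  flag_last := x.flag_last
  flag_le := x.flag_le
  flag_dim := x.flag_dim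
  t_flag := by
    rintro i _ ⟨v, hv, rfl⟩
    have h1 := x.t_flag i ⟨v, hv, rfl⟩
    have h2 := y.t_flag i ⟨v, by rw [hF]; exact hv, rfl⟩
    rw [hF] at h2
    exact add_mem h1 (Submodule.smul_mem _ _ (sub_mem h2 h1))
  range_le := by
    rintro _ ⟨v, rfl⟩
    have h1 := x.range_le ⟨v, rfl⟩
    have h2 := y.range_le ⟨v, rfl⟩
    rw [hW] at h2
    exact add_mem h1 (Submodule.smul_mem _ _ (sub_mem h2 h1))
  le_ker := by
    intro v hv
    have h1 := LinearMap.mem_ker.1 (x.le_ker hv)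
    have h2 := LinearMap.mem_ker.1 (y.le_ker (by rw [hW]; exact hv))
    simp [h1, h2]

/-- An open set that meets the line through `x` and `y` contains all but finitely many of its
points. -/
lemma TensorVariety.finite_line {x y : TensorVariety K D d} (hF : y.flag = x.flag) (hW : y.W = x.W)
    {b : Basis (Σ i : Fin k, Fin (d i)) K D} (hb : IsAdapted b w x.flag x.W)
    {U : Set (TensorVariety K D d)} (hU : IsOpen U) {s₀ : K} (h : x.line y hF hW s₀ ∈ U) :
    {s | x.line y hF hW s ∉ U}.Finite := by
  obtain ⟨O, hO, hOU⟩ := isOpen_iff_frames.1 hU (finrank K x.W)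
  let e := finBasis K x.W
  let u : FrameSpace K D d (finrank K x.W) := (b, fun a => e a, x.t)
  -- Only the endomorphism moves, so one fixed pair of bases gives frames along an affine line.
  let v : FrameSpace K D d (finrank K x.W) := (0, 0, y.t - x.t)
  have hframe : ∀ s : K, IsFrame (u + s • v) (x.line y hF hW s) := by
    intro s
    have h1 : (u + s • v).1 = b := by simp [u, v]
    have h2 : (u + s • v).2.1 = fun a => (e a : D) := by simp [u, v]
    refine ⟨?_, ?_, ?_, ?_, rfl⟩
    · rw [h1]
      exact b.linearIndependent
    · rw [h2]
      exact e.linearIndependent.map' x.W.subtype x.W.ker_subtype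
    · rw [h1]
      exact hb.flag_eq
    · rw [h2]
      change x.W = _
      have h3 := congrArg (Submodule.map x.W.subtype) e.span_eq
      rw [Submodule.map_span, Submodule.map_top, Submodule.range_subtype, ← Set.range_comp] at h3
      exact h3.symm
  have h3 := finite_compl_line hO u v (s₀ := s₀) ((hOU _ _ (hframe s₀)).2 h)
  exact h3.subset fun s hs hs' => hs ((hOU _ _ (hframe s)).1 hs')

lemma IsGreedy.matchPoint_mem_A (hM : IsGreedy w {a | IsDown w a} M) (hw : ∀ i, w i ≤ d i)
    {x : TensorVariety K D d} (hx : x ∈ Z K D d w)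
    {b : Basis (Σ i : Fin k, Fin (d i)) K D} (hb : IsAdapted b w x.flag x.W) :
    hM.matchPoint x hb ∈ A K D d w (rVec M) (nVec M) :=
  (hM.mem_A_iff hw).2 ⟨hx, fun i j _ => hM.le_imageDim_matchPoint x hb i j⟩

/-- A neighbourhood of `x` and the open set defining `A` each contain all but finitely many points
of the line from `x` to its match point; as `K` is infinite, they share one, and the line stays in
`Z`. -/
lemma IsGreedy.subset_closure_A [Infinite K] (hM : IsGreedy w {a | IsDown w a} M)
    (hw : ∀ i, w i ≤ d i) :
    Z K D d w ⊆ closure (A K D d w (rVec M) (nVec M)) := by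
  intro x hx
  rw [mem_closure_iff]
  intro U hU hxU
  obtain ⟨b, hb⟩ := exists_isAdapted hx
  obtain ⟨O, hO, hAO⟩ := hM.exists_isOpen (K := K) (D := D) hw
  let y := hM.matchPoint x hb
  have hy : y ∈ O := (hAO.subset (hM.matchPoint_mem_A hw hx hb)).1
  have h0 : x.line y rfl rfl 0 = x := by
    cases x
    simp [TensorVariety.line]
  have h1 : x.line y rfl rfl 1 = y := by
    simp only [TensorVariety.line, one_smul, add_sub_cancel]
    rfl
  have hfin := (TensorVariety.finite_line (x := x) (y := y) rfl rfl hb hU (s₀ := 0) (h0.symm ▸ hxU)).union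
    (TensorVariety.finite_line (x := x) (y := y) rfl rfl hb hO (s₀ := 1) (h1.symm ▸ hy))
  obtain ⟨s, hs⟩ := hfin.exists_notMem
  simp only [Set.mem_union, not_or] at hs
  refine ⟨_, not_not.1 hs.1, hAO.superset ⟨not_not.1 hs.2, subset_closure ?_⟩⟩
  exact hx

end Open

end TensorProductVariety

theorem mainTheorem11 {K D : Type*} [Field K] [IsAlgClosed K] [AddCommGroup D] [Module K D]
    [FiniteDimensional K D] {k : ℕ} (d w : Fin k → ℕ)
    (hd : Module.finrank K D = ∑ i, d i) (hw : ∀ i, w i ≤ d i)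
    (M : Finset (TensorProductVariety.Vertex d × TensorProductVariety.Vertex d))
    (hM : M = TensorProductVariety.crossinglessMatch d w)
    (Z A : Set (TensorProductVariety.TensorVariety K D d))
    (hZ : Z = TensorProductVariety.Z K D d w)
    (hA : A = TensorProductVariety.A K D d w
      (TensorProductVariety.rVec M) (TensorProductVariety.nVec M)) :
    (A ⊆ closure Z ∧
      IsOpen (Subtype.val ⁻¹' A : Set (closure Z)) ∧
      Dense (Subtype.val ⁻¹' A : Set (closure Z)) ∧
      closure A = closure Z) ∧
    ∀ x ∈ Z, ∀ b : Module.Basis (Σ i : Fin k, Fin (d i)) K D,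
      TensorProductVariety.IsAdapted b w x.flag x.W →
      (x ∈ A ↔ ∀ p q : Fin k, p < q → ((p : ℕ) = 0 ∨ (q : ℕ) + 1 = k) →
        TensorProductVariety.HasMaxRank x b w p q) ∧
      ∃ y : TensorProductVariety.TensorVariety K D d, y.flag = x.flag ∧ y.W = x.W ∧
        ∀ p q : Fin k, p < q → TensorProductVariety.HasMaxRank y b w p q := by
  have hG := TensorProductVariety.isGreedy_crossinglessMatch d w
  have : Infinite K := IsAlgClosed.instInfinite
  subst hM hZ hA
  refine ⟨?_, fun x hx b hb => ⟨hG.mem_A_iff_hasMaxRank hw hx hb, hG.matchPoint x hb, rfl, rfl,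
    fun p q hpq => ?_⟩⟩
  · have hsub := hG.subset_closure_A (K := K) (D := D) hw
    obtain ⟨U, hU, hAU⟩ := hG.exists_isOpen (K := K) (D := D) hw
    have hAZ := hAU.subset.trans Set.inter_subset_right
    refine ⟨hAZ, ?_, ?_, (closure_minimal hAZ isClosed_closure).antisymm
      (closure_minimal hsub isClosed_closure)⟩
    · rw [hAU]
      convert hU.preimage continuous_subtype_val using 1
      ext x
      simp
    · rw [Subtype.dense_iff, Subtype.image_preimage_coe, Set.inter_eq_right.2 hAZ]
      exact closure_minimal hsub isClosed_closure
  -- The same match point attains the curve count in every interval.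
  · exact (hG.hasMaxRank_iff (x := hG.matchPoint x hb) hw hx hb hpq).2
      (hG.le_imageDim_matchPoint x hb _ _)
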